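/- Let $p$ be a prime and $n\ge 1$. Let $\mathcal{L}_n=(\mathbb{Z}/p\mathbb{Z})^n\wr\mathbb{Z}=\bigl(\bigoplus_{\mathbb{Z}}(\mathbb{Z}/p\mathbb{Z})^n\bigr)\rtimes\mathbb{Z}$, where $\mathbb{Z}$ acts by shifts, and let $R=\mathbb{F}_p[x,x^{-1}]$. Let $$\zeta_n(z)=\sum_{N\lhd\mathcal{L}_n,\ [\mathcal{L}_n:N]<\infty}[\mathcal{L}_n:N]^{-z},\qquad \xi_n(z)=\sum_{M\le R^n,\ [R^n:M]<\infty}[R^n:M]^{-z}$$ be the normal-subgroup zeta function of $\mathcal{L}_n$ and the zeta function of the $R$-module $R^n$ (the second sum is over $R$-submodules). For $m\ge1$ let $a^{\triangleleft}_m$ be the number of normal subgroups of $\mathcal{L}_n$ of index $m$ and $c_m$ the number of submodules of $R^n$ of index $m$. For a prime $r\in R$ let $\mathrm{Mod}_r$ be the set of submodules $M\le R^n$ with $r^kR^n\subseteq M$ for some $k\ge 0$, and for $M\in\mathrm{Mod}_{1-x}$ of finite index let $\tau(M)$ be the order of the kernel of multiplication by $1-x$ on $R^n/M$. Then: 1.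 All $a^{\triangleleft}_m$ and $c_m$ are finite. For $\operatorname{Re} z>n$ the series $\zeta_n(z)$ and $\xi_n(z)$ converge absolutely, $\zeta_n(z)=\sum_{m\ge1}a^{\triangleleft}_m m^{-z}$ and $\xi_n(z)=\sum_{m\ge1}c_m m^{-z}$. 2. At every $z\in\mathbb{C}$ where the series $\zeta_n(z)$ converges absolutely (in particular for $\operatorname{Re}z>n$), $$\zeta_n(z)=\sum_{s\ge1}s^{-z}\prod_{\substack{r\in R\text{ prime}\\ r\mid 1-x^s,\ r\ne 1-x}}\Bigl(\sum_{\substack{M\in\mathrm{Mod}_r\\ (1-x^s)R^n\subseteq M}}[R^n:M]^{-z}\Bigr)\cdot\Bigl(\sum_{\substack{M\in\mathrm{Mod}_{1-x}\\ (1-x^s)R^n\subseteq M}}\tau(M)[R^n:M]^{-z}\Bigr),$$ where the outer series converges absolutely and primes $r$ are taken up to units, each represented by its associate in $\mathbb{F}_p[x]$ with constant term $1$. 3. The Dirichlet series $\zeta_n(z)$ is bounded coefficientwise by $p^n\zeta(z)\xi_n(z)$, where $\zeta$ is the Riemann zeta function; that is, $a^{\triangleleft}_m\le p^n\sum_{d\mid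 m}c_d$ for all $m\ge1$. 4. For $\operatorname{Re}z>n$, $\displaystyle \xi_n(z)=\frac{p^z-1}{p^z-p^n}$. 5. For every $m$ the number $s^{\triangleleft}_m(\mathcal{L}_n)$ of normal subgroups of $\mathcal{L}_n$ of index at most $m$ is finite, and $$\limsup_{m\to\infty}\frac{\log s^{\triangleleft}_m(\mathcal{L}_n)}{\log m}\le n.$$ -/

import Mathlib

open Filter Polynomial LaurentPolynomial

noncomputable section

namespace Lamplighter

/-- The base group `⨁_ℤ (ℤ/p)ⁿ`, written additively. -/
abbrev Base (p n : ℕ) : Type := ℤ →₀ (Fin n → ZMod p)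

/-- The right shift by one on the base group: `(shift v) (j + 1) = v j`. -/
def shift (p n : ℕ) : Base p n ≃+ Base p n :=
  Finsupp.domCongr (Equiv.addRight (1 : ℤ))

/-- The action of `ℤ` on the base group: the generator acts as the right shift by one. -/
def shiftAction (p n : ℕ) : Multiplicative ℤ →* MulAut (Multiplicative (Base p n)) :=
  zpowersHom (MulAut (Multiplicative (Base p n))) (AddEquiv.toMultiplicative (shift p n))

/-- The (restricted) wreath product `(ℤ/p)ⁿ ≀ ℤ = (⨁_ℤ (ℤ/p)ⁿ) ⋊ ℤ`. -/
abbrev L (p n : ℕ) : Type :=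
  SemidirectProduct (Multiplicative (Base p n)) (Multiplicative ℤ) (shiftAction p n)

/-- The ring of Laurent polynomials over `𝔽_p`; the variable is `T 1`. -/
abbrev R (p : ℕ) : Type := LaurentPolynomial (ZMod p)

/-- The free module `Rⁿ`. -/
abbrev Rn (p n : ℕ) : Type := Fin n → R p

/-- The index `[Rⁿ : M]`, with the value `0` when the index is infinite. -/
def idx {p n : ℕ} (M : Submodule (R p) (Rn p n)) : ℕ := M.toAddSubgroup.index

/-- The normal subgroups of finite index of `(ℤ/p)ⁿ ≀ ℤ`. -/
abbrev FinIndexNormal (p n : ℕ) : Type := {N : Subgroup (L p n) // N.Normal ∧ N.index ≠ 0}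

/-- The submodules of finite index of `Rⁿ`. -/
abbrev FinIndexSubmodule (p n : ℕ) : Type := {M : Submodule (R p) (Rn p n) // idx M ≠ 0}

/-- The normal-subgroup zeta function of `(ℤ/p)ⁿ ≀ ℤ`. -/
def normalZeta (p n : ℕ) (z : ℂ) : ℂ := ∑' N : FinIndexNormal p n, (N.1.index : ℂ) ^ (-z)

/-- The zeta function of the module `Rⁿ`. -/
def moduleZeta (p n : ℕ) (z : ℂ) : ℂ := ∑' M : FinIndexSubmodule p n, (idx M.1 : ℂ) ^ (-z)

/-- The number of normal subgroups of index `m` (for `m ≥ 1`). -/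
def normalCount (p n : ℕ) : ArithmeticFunction ℕ where
  toFun m := if m = 0 then 0 else {N : Subgroup (L p n) | N.Normal ∧ N.index = m}.ncard
  map_zero' := by simp

/-- The number of submodules of `Rⁿ` of index `m` (for `m ≥ 1`). -/
def submoduleCount (p n : ℕ) : ArithmeticFunction ℕ where
  toFun m := if m = 0 then 0 else {M : Submodule (R p) (Rn p n) | idx M = m}.ncard
  map_zero' := by simp

/-- The set of normal subgroups of finite index at most `m`. -/
def normalUpTo (p n m : ℕ) : Set (Subgroup (L p n)) :=
  {N | N.Normal ∧ N.index ≠ 0 ∧ N.index ≤ m}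

/-- `Mod_r`: the submodules `M` of `Rⁿ` with `r ^ k Rⁿ ⊆ M` for some `k`. -/
def PrimaryMod (p n : ℕ) (r : R p) : Set (Submodule (R p) (Rn p n)) :=
  {M | ∃ k : ℕ, ∀ v : Rn p n, r ^ k • v ∈ M}

/-- The members `M` of `Mod_r` with `(1 - x ^ s) Rⁿ ⊆ M`. -/
def PrimaryModOver (p n : ℕ) (r : R p) (s : ℕ) : Set (Submodule (R p) (Rn p n)) :=
  {M | M ∈ PrimaryMod p n r ∧ ∀ v : Rn p n, (1 - T (s : ℤ) : R p) • v ∈ M}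

/-- The primes `r` of `R` that divide `1 - x ^ s` and differ from `1 - x`. Primes are taken up to
units: each class of associates is represented by its only element that is a polynomial with
constant term `1`. -/
def otherPrimes (p s : ℕ) : Set (R p) :=
  {r | Prime r ∧ (∃ q : (ZMod p)[X], q.coeff 0 = 1 ∧ Polynomial.toLaurent q = r) ∧
    r ∣ (1 - T (s : ℤ) : R p) ∧ r ≠ 1 - T 1}

/-- `τ(M)`: the order of the kernel of multiplication by `1 - x` on `Rⁿ / M`. -/
def tau {p n : ℕ} (M : Submodule (R p) (Rn p n)) : ℕ :=
  Nat.card (LinearMap.ker (LinearMap.lsmul (R p) (Rn p n ⧸ M) (1 - T 1)))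

/-- The local factor at a prime `r ≠ 1 - x` (a finite sum). -/
def localFactor (p n : ℕ) (r : R p) (s : ℕ) (z : ℂ) : ℂ :=
  ∑ᶠ M ∈ PrimaryModOver p n r s, (idx M : ℂ) ^ (-z)

/-- The local factor at the prime `1 - x` (a finite sum). -/
def tauFactor (p n : ℕ) (s : ℕ) (z : ℂ) : ℂ :=
  ∑ᶠ M ∈ PrimaryModOver p n (1 - T 1) s, (tau M : ℂ) * (idx M : ℂ) ^ (-z)

end Lamplighter

end

noncomputable section

namespace Lamplighter

section Laurent

variable {K : Type*} [Field K]

theorem isCoprime_X_pow_of_coeff_zero {q : K[X]} (hq : q.coeff 0 = 1) (n : ℕ) :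
    IsCoprime q (X ^ n) := by
  apply IsCoprime.pow_right
  have h := divX_mul_X_add q
  rw [hq] at h
  refine ⟨1, -divX q, ?_⟩
  rw [one_mul]
  nth_rewrite 1 [← h]
  simp

theorem toLaurent_dvd_iff {q : K[X]} (hq : q.coeff 0 = 1) (f : K[X]) :
    toLaurent q ∣ toLaurent f ↔ q ∣ f := by
  refine ⟨fun ⟨g, hg⟩ => ?_, fun h => map_dvd _ h⟩
  obtain ⟨n, g', hg'⟩ := exists_T_pow g
  have h : X ^ n * f = q * g' := by
    apply toLaurent_injective
    rw [map_mul, map_mul, hg', hg, toLaurent_X_pow]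
    ring
  exact (isCoprime_X_pow_of_coeff_zero hq n).dvd_of_dvd_mul_left ⟨g', h⟩

theorem exists_associated_toLaurent {f : K[T;T⁻¹]} (hf : f ≠ 0) :
    ∃ q : K[X], q.coeff 0 = 1 ∧ Associated (toLaurent q) f := by
  obtain ⟨n, f', hf'⟩ := exists_T_pow f
  have h0 : f' ≠ 0 := by
    rintro rfl
    rw [map_zero] at hf'
    exact mul_ne_zero hf (isUnit_T n).ne_zero hf'.symm
  obtain ⟨k, g, hk, hg⟩ : ∃ (k : ℕ) (g : K[X]), f' = X ^ k * g ∧ ¬ X ∣ g := by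
    have := FiniteMultiplicity.of_not_isUnit (a := (X : K[X])) not_isUnit_X h0
    exact ⟨_, this.exists_eq_pow_mul_and_not_dvd.choose,
      this.exists_eq_pow_mul_and_not_dvd.choose_spec⟩
  rw [X_dvd_iff] at hg
  refine ⟨Polynomial.C (g.coeff 0)⁻¹ * g, by simp [hg], ?_⟩
  have h1 : Associated (toLaurent f') f := by
    rw [hf']
    exact (associated_mul_unit_left _ _ (isUnit_T _))
  refine Associated.trans ?_ h1
  rw [hk, map_mul, map_mul, toLaurent_X_pow]
  refine (associated_unit_mul_left _ _ ?_).trans (associated_unit_mul_right _ _ (isUnit_T _))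
  exact (isUnit_C.2 (isUnit_iff_ne_zero.2 (inv_ne_zero hg))).map _

theorem eq_of_associated_toLaurent {q₁ q₂ : K[X]} (h₁ : q₁.coeff 0 = 1) (h₂ : q₂.coeff 0 = 1)
    (h : Associated (toLaurent q₁) (toLaurent q₂)) : q₁ = q₂ := by
  have h' : Associated q₁ q₂ := associated_of_dvd_dvd
    ((toLaurent_dvd_iff h₁ _).1 h.dvd) ((toLaurent_dvd_iff h₂ _).1 h.symm.dvd)
  obtain ⟨u, rfl⟩ := h'
  obtain ⟨c, -, hc⟩ := Polynomial.isUnit_iff.1 u.isUnit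
  rw [← hc] at h₂ ⊢
  rw [coeff_mul_C, h₁, one_mul] at h₂
  simp [h₂]

theorem prime_toLaurent {q : K[X]} (hq : q.coeff 0 = 1) (hp : Prime q) :
    Prime (toLaurent q) := by
  refine ⟨toLaurent_ne_zero.2 hp.ne_zero, fun h => hp.not_isUnit ?_, fun a b hab => ?_⟩
  · rw [isUnit_iff_dvd_one, ← toLaurent_one, toLaurent_dvd_iff hq] at h
    exact isUnit_iff_dvd_one.2 h
  · obtain ⟨n, a', ha⟩ := exists_T_pow a
    obtain ⟨m, b', hb⟩ := exists_T_pow b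
    have h : toLaurent q ∣ toLaurent (a' * b') := by
      rw [map_mul, ha, hb]
      exact hab.trans ⟨T n * T m, by ring⟩
    rw [toLaurent_dvd_iff hq] at h
    refine (hp.2.2 _ _ h).imp (fun h => ?_) (fun h => ?_)
    · have := map_dvd toLaurent h
      rwa [ha, (isUnit_T _).dvd_mul_right] at this
    · have := map_dvd toLaurent h
      rwa [hb, (isUnit_T _).dvd_mul_right] at this

theorem toLaurent_one_sub_X : toLaurent (1 - X : K[X]) = 1 - T 1 := by
  simp

theorem prime_one_sub_T : Prime (1 - T 1 : K[T;T⁻¹]) := by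
  rw [← toLaurent_one_sub_X]
  refine prime_toLaurent (by simp) ?_
  have : (1 - X : K[X]) = -(X - Polynomial.C 1) := by simp
  rw [this]
  exact (prime_X_sub_C 1).neg

instance isPrincipalIdealRing_laurent : IsPrincipalIdealRing K[T;T⁻¹] where
  principal I := by
    obtain ⟨g, hg⟩ := IsPrincipalIdealRing.principal (Ideal.under K[X] I)
    refine ⟨toLaurent g, ?_⟩
    rw [← IsLocalization.map_under (Submonoid.powers (X : K[X])) K[T;T⁻¹] I, hg]
    exact Ideal.map_span _ _ |>.trans (by rw [Set.image_singleton]; rfl)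

/-- The quotient map `K[X] → K[T;T⁻¹] ⧸ (q)`. -/
def quotMap (q : K[X]) : K[X] →+* K[T;T⁻¹] ⧸ Ideal.span {toLaurent q} :=
  (Ideal.Quotient.mk _).comp toLaurent

theorem quotMap_surjective {q : K[X]} (hq : q.coeff 0 = 1) :
    Function.Surjective (quotMap q) := by
  intro f
  obtain ⟨f, rfl⟩ := Ideal.Quotient.mk_surjective f
  obtain ⟨n, f', hf⟩ := exists_T_pow f
  obtain ⟨a, b, hab⟩ := isCoprime_X_pow_of_coeff_zero hq n
  refine ⟨b * f', Ideal.Quotient.eq.2 (Ideal.mem_span_singleton.2 ?_)⟩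
  have h := congrArg toLaurent hab
  rw [map_add, map_mul, map_mul, toLaurent_X_pow, map_one] at h
  refine ⟨-toLaurent a * f, ?_⟩
  rw [map_mul, hf]
  linear_combination f * h

theorem ker_quotMap {q : K[X]} (hq : q.coeff 0 = 1) :
    RingHom.ker (quotMap q) = Ideal.span {q} := by
  ext f
  rw [RingHom.mem_ker, quotMap, RingHom.comp_apply, Ideal.Quotient.eq_zero_iff_mem,
    Ideal.mem_span_singleton, Ideal.mem_span_singleton, toLaurent_dvd_iff hq]

theorem natCard_quotient_span_toLaurent [Finite K] {q : K[X]} (hq : q.coeff 0 = 1) :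
    Nat.card (K[T;T⁻¹] ⧸ Ideal.span {toLaurent q}) = Nat.card K ^ q.natDegree := by
  have h0 : q ≠ 0 := by rintro rfl; simp at hq
  rw [← Nat.card_congr (RingHom.quotientKerEquivOfSurjective (quotMap_surjective hq)).toEquiv,
    ker_quotMap hq, ← finrank_quotient_span_eq_natDegree]
  have : Module.Finite K (K[X] ⧸ Ideal.span {q}) :=
    (AdjoinRoot.powerBasis h0).finite
  exact Module.natCard_eq_pow_finrank

end Laurent

variable {p : ℕ} [Fact p.Prime]

instance : Infinite (R p) := by
  refine Infinite.of_injective (fun n : ℕ => (T n : R p)) fun a b h => ?_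
  have := congrArg LaurentPolynomial.degree h
  simpa [LaurentPolynomial.degree_T] using this

theorem index_span_toLaurent {q : (ZMod p)[X]} (hq : q.coeff 0 = 1) :
    (Ideal.span {toLaurent q}).toAddSubgroup.index = p ^ q.natDegree := by
  have h := natCard_quotient_span_toLaurent hq
  rw [Nat.card_zmod] at h
  exact h

theorem index_bot : (⊥ : Ideal (R p)).toAddSubgroup.index = 0 := by
  rw [Submodule.bot_toAddSubgroup, AddSubgroup.index_bot, Nat.card_eq_zero_of_infinite]

variable (p) in
/-- The ideals of finite index of `R`. -/
abbrev FinIndexIdeal : Type := {I : Ideal (R p) // I.toAddSubgroup.index ≠ 0}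

variable (p) in
/-- The polynomials with constant term `1`. -/
abbrev UnitConst : Type := {q : (ZMod p)[X] // q.coeff 0 = 1}

/-- The ideal generated by a polynomial with constant term `1`. -/
def UnitConst.toIdeal (q : UnitConst p) : FinIndexIdeal p :=
  ⟨Ideal.span {toLaurent q.1}, by
    rw [index_span_toLaurent q.2]; exact pow_ne_zero _ (Fact.out : p.Prime).ne_zero⟩

theorem UnitConst.toIdeal_bijective : Function.Bijective (UnitConst.toIdeal (p := p)) := by
  refine ⟨fun q₁ q₂ h => ?_, fun ⟨I, hI⟩ => ?_⟩
  · have := congrArg Subtype.val h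
    exact Subtype.ext (eq_of_associated_toLaurent q₁.2 q₂.2
      (Ideal.span_singleton_eq_span_singleton.1 this))
  · obtain ⟨f, rfl⟩ := IsPrincipalIdealRing.principal I
    have hf : f ≠ 0 := by
      rintro rfl
      refine hI ?_
      rw [Submodule.span_zero_singleton, index_bot]
    obtain ⟨q, hq, h⟩ := exists_associated_toLaurent hf
    exact ⟨⟨q, hq⟩, Subtype.ext (Ideal.span_singleton_eq_span_singleton.2 h)⟩

theorem ne_bot_of_index_ne_zero {I : Ideal (R p)} (h : I.toAddSubgroup.index ≠ 0) : I ≠ ⊥ := by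
  rintro rfl
  exact h index_bot

theorem index_span_singleton_ne_zero {f : R p} (hf : f ≠ 0) :
    (Ideal.span {f}).toAddSubgroup.index ≠ 0 := by
  obtain ⟨q, hq, h⟩ := exists_associated_toLaurent hf
  rw [← Ideal.span_singleton_eq_span_singleton.2 h]
  exact (UnitConst.toIdeal ⟨q, hq⟩).2

section Fibers

variable {ι : Type*} (ℓ : ι → ℕ) (g : ℕ → ℂ)

theorem finite_fiber_of_summable (h : Summable fun i => g (ℓ i)) {k : ℕ} (hk : g k ≠ 0) :
    {i | ℓ i = k}.Finite := by
  have h1 := h.tendsto_cofinite_zero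
  have h2 : {w : ℂ | w ≠ g k} ∈ nhds (0 : ℂ) := isOpen_ne.mem_nhds hk.symm
  have h3 := h1 h2
  rw [mem_map, mem_cofinite] at h3
  refine h3.subset fun i hi => ?_
  simp only [Set.mem_ofPred_eq] at hi
  simp [hi]

theorem hasSum_sigma_const_iff {α : Type*} {β : α → Type*} [∀ a, Finite (β a)] (f : α → ℂ) (S : ℂ) :
    HasSum (fun x : Σ a, β a => f x.1) S ↔ HasSum (fun a => (Nat.card (β a) : ℂ) * f a) S := by
  have hf (a : α) (c : ℂ) : HasSum (fun _ : β a => c) (Nat.card (β a) * c) := by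
    have := Fintype.ofFinite (β a)
    have h := hasSum_fintype (fun _ : β a => c)
    rwa [Finset.sum_const, Finset.card_univ, ← Nat.card_eq_fintype_card, nsmul_eq_mul] at h
  refine ⟨fun h => h.sigma fun a => hf a (f a), fun h => ?_⟩
  have hs : Summable fun x : Σ a, β a => f x.1 := by
    rw [← summable_norm_iff, summable_sigma_of_nonneg fun _ => norm_nonneg _]
    have hk (a : α) : HasSum (fun _ : β a => ‖f a‖) ‖(Nat.card (β a) : ℂ) * f a‖ := by
      have := hf a (‖f a‖ : ℂ)
      rw [norm_mul, Complex.norm_natCast]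
      exact_mod_cast this
    refine ⟨fun a => (hk a).summable, ?_⟩
    convert h.summable.norm with a
    exact (hk a).tsum_eq
  rw [h.unique (hs.hasSum.sigma fun a => hf a (f a))]
  exact hs.hasSum

theorem hasSum_comp_iff {S : ℂ} (hfin : ∀ k, {i | ℓ i = k}.Finite) :
    HasSum (fun i => g (ℓ i)) S ↔ HasSum (fun k => ({i | ℓ i = k}.ncard : ℂ) * g k) S := by
  have (k : ℕ) : Finite {i // ℓ i = k} := hfin k
  rw [← (Equiv.sigmaFiberEquiv ℓ).hasSum_iff]
  refine Iff.trans (iff_of_eq ?_) (hasSum_sigma_const_iff (β := fun k => {i // ℓ i = k}) g S)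
  congr 1
  funext x
  simp [Equiv.sigmaFiberEquiv, x.2.2]

theorem hasSum_mul_prod {α β : Type*} {f : α → ℂ} {g : β → ℂ} {a b : ℂ} (hf : HasSum f a)
    (hg : HasSum g b) : HasSum (fun x : α × β => f x.1 * g x.2) (a * b) :=
  hf.mul hg (summable_mul_of_summable_norm hf.summable.norm hg.summable.norm)

end Fibers

section IdealZeta

theorem natCast_pow_cpow (p k : ℕ) (z : ℂ) :
    ((p ^ k : ℕ) : ℂ) ^ (-z) = ((p : ℂ) ^ (-z)) ^ k := by
  rw [Nat.cast_pow, ← Complex.natCast_cpow_natCast_mul, mul_comm, Complex.cpow_mul_nat]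

variable {p : ℕ} [Fact p.Prime]

theorem one_lt_natCast_prime : (1 : ℝ) < p := by exact_mod_cast (Fact.out : p.Prime).one_lt

theorem natCast_prime_ne_zero : (p : ℂ) ≠ 0 := by exact_mod_cast (Fact.out : p.Prime).ne_zero

theorem norm_prime_cpow (z : ℂ) : ‖(p : ℂ) ^ z‖ = (p : ℝ) ^ z.re :=
  Complex.norm_natCast_cpow_of_pos (Fact.out : p.Prime).pos z

theorem ncard_unitConst_lt (j : ℕ) :
    {q : UnitConst p | q.1.natDegree < j + 1}.Finite ∧
    {q : UnitConst p | q.1.natDegree < j + 1}.ncard = p ^ j := by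
  let e : degreeLT (ZMod p) j ≃ {q : UnitConst p | q.1.natDegree < j + 1} :=
    { toFun := fun g => ⟨⟨1 + g.1 * X, by simp⟩, by
        have h := mem_degreeLT.1 g.2
        rw [Set.mem_ofPred_eq, Nat.lt_succ_iff, natDegree_le_iff_coeff_eq_zero]
        intro N hN
        obtain ⟨M, rfl⟩ : ∃ M, N = M + 1 := ⟨N - 1, by omega⟩
        rw [coeff_add, coeff_mul_X, coeff_one, if_neg (by omega), zero_add]
        exact coeff_eq_zero_of_degree_lt (h.trans_le (by exact_mod_cast (by omega : j ≤ M)))⟩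
      invFun := fun q => ⟨divX q.1.1, by
        have h : q.1.1.natDegree < j + 1 := q.2
        rw [mem_degreeLT, degree_lt_iff_coeff_zero]
        intro m hm
        rw [coeff_divX]
        exact coeff_eq_zero_of_natDegree_lt (by omega)⟩
      left_inv := fun g => by
        apply Subtype.ext
        ext m
        simp [coeff_divX, coeff_one]
      right_inv := fun q => by
        apply Subtype.ext
        apply Subtype.ext
        have h := divX_mul_X_add q.1.1
        rw [q.1.2] at h
        simp only
        nth_rewrite 2 [← h]
        simp [add_comm] }
  have hc : Nat.card {q : UnitConst p | q.1.natDegree < j + 1} = p ^ j := by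
    rw [← Nat.card_congr e, Nat.card_congr (degreeLTEquiv (ZMod p) j).toEquiv]
    simp
  refine ⟨?_, hc⟩
  have hp : p ^ j ≠ 0 := pow_ne_zero _ (Fact.out : p.Prime).ne_zero
  rw [← hc] at hp
  exact Set.finite_coe_iff.1 (Nat.finite_of_card_ne_zero hp)

theorem finite_unitConst_natDegree (j : ℕ) : {q : UnitConst p | q.1.natDegree = j}.Finite :=
  (ncard_unitConst_lt j).1.subset fun q hq => by
    simp only [Set.mem_ofPred_eq] at hq ⊢
    omega

theorem ncard_unitConst_zero : {q : UnitConst p | q.1.natDegree = 0}.ncard = 1 := by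
  have := (ncard_unitConst_lt (p := p) 0).2
  simpa using this

theorem ncard_unitConst_succ (j : ℕ) :
    ({q : UnitConst p | q.1.natDegree = j + 1}.ncard : ℂ) = (p - 1) * p ^ j := by
  have h : {q : UnitConst p | q.1.natDegree < j + 1 + 1} =
      {q : UnitConst p | q.1.natDegree = j + 1} ∪ {q : UnitConst p | q.1.natDegree < j + 1} := by
    ext q
    simp only [Set.mem_union, Set.mem_ofPred_eq]
    omega
  have h2 := (ncard_unitConst_lt (p := p) (j + 1)).2
  rw [h, Set.ncard_union_eq _ (finite_unitConst_natDegree _) (ncard_unitConst_lt j).1,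
    (ncard_unitConst_lt j).2] at h2
  · have h3 := congrArg (Nat.cast (R := ℂ)) h2
    push_cast at h3
    rw [eq_sub_of_add_eq h3]
    ring
  · rw [Set.disjoint_left]
    intro q hq hq'
    simp only [Set.mem_ofPred_eq] at hq hq'
    omega

theorem hasSum_finIndexIdeal {z : ℂ} (hz : 1 < z.re) :
    HasSum (fun I : FinIndexIdeal p => (I.1.toAddSubgroup.index : ℂ) ^ (-z))
      (((p : ℂ) ^ z - 1) / ((p : ℂ) ^ z - p)) := by
  rw [← (Equiv.ofBijective _ UnitConst.toIdeal_bijective).hasSum_iff]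
  have hfun : ((fun I : FinIndexIdeal p => (I.1.toAddSubgroup.index : ℂ) ^ (-z)) ∘
      (Equiv.ofBijective _ UnitConst.toIdeal_bijective)) =
      fun q : UnitConst p => ((p : ℂ) ^ (-z)) ^ q.1.natDegree := by
    funext q
    simp only [Function.comp_apply, Equiv.ofBijective_apply, UnitConst.toIdeal]
    rw [index_span_toLaurent q.2, natCast_pow_cpow]
  rw [hfun]
  set u : ℂ := (p : ℂ) ^ (-z) with hu
  have hpu : ‖(p : ℂ) * u‖ < 1 := by
    rw [norm_mul, norm_prime_cpow, Complex.norm_natCast, Complex.neg_re]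
    calc (p : ℝ) * (p : ℝ) ^ (-z.re) = (p : ℝ) ^ (1 - z.re) := by
          rw [sub_eq_add_neg, Real.rpow_add (by linarith [one_lt_natCast_prime (p := p)]),
            Real.rpow_one]
      _ < 1 := Real.rpow_lt_one_of_one_lt_of_neg one_lt_natCast_prime (by linarith)
  rw [hasSum_comp_iff (fun q : UnitConst p => q.1.natDegree) (fun k => u ^ k)
    finite_unitConst_natDegree]
  rw [← hasSum_nat_add_iff' 1]
  simp only [Finset.range_one, Finset.sum_singleton, ncard_unitConst_zero, Nat.cast_one, pow_zero,
    mul_one]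
  have hg := (hasSum_geometric_of_norm_lt_one hpu).mul_left (((p : ℂ) - 1) * u)
  convert hg using 1
  · rfl
  · funext k
    rw [ncard_unitConst_succ, mul_pow]
    ring
  · have hw : (p : ℂ) ^ z = u⁻¹ := by rw [hu, Complex.cpow_neg, inv_inv]
    have hu0 : u ≠ 0 := by
      rw [hu]
      simp [Complex.cpow_eq_zero_iff, natCast_prime_ne_zero (p := p)]
    have h1 : 1 - (p : ℂ) * u ≠ 0 := by
      intro h
      rw [sub_eq_zero] at h
      rw [← h, norm_one] at hpu
      exact lt_irrefl _ hpu
    have h2 : u⁻¹ - (p : ℂ) = (1 - p * u) * u⁻¹ := by field_simp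
    rw [hw, h2, div_sub_one (mul_ne_zero h1 (inv_ne_zero hu0)),
      div_eq_iff (mul_ne_zero h1 (inv_ne_zero hu0)), mul_assoc,
      inv_mul_cancel_left₀ h1]
    field_simp
    ring

end IdealZeta

/-- The index of a normal subgroup of an extension is the product of the indices of its trace on
the kernel and of its image in the quotient. -/
@[to_additive]
theorem index_eq_index_comap_mul_index_map {A G Q : Type*} [Group A] [Group G] [Group Q]
    (i : A →* G) (q : G →* Q) (hq : Function.Surjective q) (h : q.ker = i.range)
    (N : Subgroup G) [N.Normal] : N.index = (N.comap i).index * (N.map q).index := by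
  rw [Subgroup.index_map, MonoidHom.range_eq_top.2 hq, Subgroup.index_top, mul_one,
    Subgroup.index_comap, ← h, ← Subgroup.relIndex_sup_left,
    Subgroup.relIndex_mul_index le_sup_left]

section Extension

variable {A : Type*} [CommRing A] {n : ℕ}

variable (A n) in
/-- The inclusion of `Aⁿ` into `Aⁿ⁺¹` as the kernel of the first coordinate. -/
def consZero : (Fin n → A) →ₗ[A] (Fin (n + 1) → A) where
  toFun v := Fin.cons 0 v
  map_add' v w := by
    ext j
    refine Fin.cases ?_ (fun _ => ?_) j <;> simp
  map_smul' a v := by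
    ext j
    refine Fin.cases ?_ (fun _ => ?_) j <;> simp

theorem consZero_apply (v : Fin n → A) : consZero A n v = Fin.cons 0 v := rfl

/-- The submodule of `Aⁿ⁺¹` generated by `(f, v)` and `0 × M`. -/
def extend (f : A) (M : Submodule A (Fin n → A)) (v : Fin n → A) :
    Submodule A (Fin (n + 1) → A) where
  carrier := {u | ∃ a : A, u 0 = a * f ∧ Fin.tail u - a • v ∈ M}
  zero_mem' := ⟨0, by simp, by
    have : Fin.tail (0 : Fin (n + 1) → A) = 0 := rfl
    simp [this]⟩
  add_mem' := by
    rintro u w ⟨a, ha, hu⟩ ⟨b, hb, hw⟩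
    refine ⟨a + b, by rw [Pi.add_apply, ha, hb]; ring, ?_⟩
    have : Fin.tail (u + w) - (a + b) • v = (Fin.tail u - a • v) + (Fin.tail w - b • v) := by
      have h : Fin.tail (u + w) = Fin.tail u + Fin.tail w := rfl
      rw [h]
      module
    rw [this]
    exact M.add_mem hu hw
  smul_mem' := by
    rintro c u ⟨a, ha, hu⟩
    refine ⟨c * a, by rw [Pi.smul_apply, ha, smul_eq_mul]; ring, ?_⟩
    have : Fin.tail (c • u) - (c * a) • v = c • (Fin.tail u - a • v) := by
      have h : Fin.tail (c • u) = c • Fin.tail u := rfl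
      rw [h]
      module
    rw [this]
    exact M.smul_mem c hu

theorem mem_extend {f : A} {M : Submodule A (Fin n → A)} {v : Fin n → A} {u : Fin (n + 1) → A} :
    u ∈ extend f M v ↔ ∃ a : A, u 0 = a * f ∧ Fin.tail u - a • v ∈ M := Iff.rfl

theorem cons_mem_extend (f : A) (M : Submodule A (Fin n → A)) (v : Fin n → A) :
    Fin.cons f v ∈ extend f M v :=
  ⟨1, by simp, by simp⟩

theorem map_proj_extend (f : A) (M : Submodule A (Fin n → A)) (v : Fin n → A) :
    (extend f M v).map (LinearMap.proj 0) = Ideal.span {f} := by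
  ext x
  rw [Submodule.mem_map, Ideal.mem_span_singleton']
  constructor
  · rintro ⟨u, ⟨a, ha, -⟩, rfl⟩
    exact ⟨a, ha.symm⟩
  · rintro ⟨a, rfl⟩
    exact ⟨a • Fin.cons f v, Submodule.smul_mem _ a (cons_mem_extend f M v), by simp⟩

theorem comap_consZero_extend [IsDomain A] {f : A} (hf : f ≠ 0) (M : Submodule A (Fin n → A))
    (v : Fin n → A) : (extend f M v).comap (consZero A n) = M := by
  ext w
  rw [Submodule.mem_comap, consZero_apply, mem_extend]
  constructor
  · rintro ⟨a, ha, h⟩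
    have : a = 0 := by simpa [hf] using ha.symm
    simpa [this] using h
  · exact fun h => ⟨0, by simp, by simpa using h⟩

theorem sub_mem_of_extend_eq [IsDomain A] {f : A} (hf : f ≠ 0) {M : Submodule A (Fin n → A)}
    {v w : Fin n → A} (h : extend f M v = extend f M w) : v - w ∈ M := by
  obtain ⟨a, ha, h'⟩ := h ▸ cons_mem_extend f M v
  have : a = 1 := by
    rw [Fin.cons_zero] at ha
    exact (mul_eq_right₀ hf).1 ha.symm
  simpa [this] using h'

theorem extend_congr {f : A} {M : Submodule A (Fin n → A)}
    {v w : Fin n → A} (h : v - w ∈ M) : extend f M v = extend f M w := by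
  ext u
  refine exists_congr fun a => and_congr_right fun _ => ?_
  rw [← Submodule.sub_mem_iff_left (x := Fin.tail u - a • w) M (M.smul_mem a h)]
  congr! 1
  module

theorem exists_eq_extend {f : A} (N : Submodule A (Fin (n + 1) → A))
    (h : N.map (LinearMap.proj 0) = Ideal.span {f}) :
    ∃ v, N = extend f (N.comap (consZero A n)) v := by
  have hm : f ∈ N.map (LinearMap.proj 0) := h ▸ Ideal.mem_span_singleton_self f
  obtain ⟨u, hu, huf⟩ := hm
  have key (a : A) (w : Fin (n + 1) → A) (hw : w 0 = a * f) :
      consZero A n (Fin.tail w - a • Fin.tail u) = w - a • u := by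
    ext j
    rw [consZero_apply]
    refine Fin.cases ?_ (fun j => ?_) j
    · have : u 0 = f := huf
      simp [hw, this]
    · simp [Fin.tail]
  refine ⟨Fin.tail u, Submodule.ext fun w => ⟨fun hw => ?_, ?_⟩⟩
  · have : w 0 ∈ N.map (LinearMap.proj 0) := ⟨w, hw, rfl⟩
    rw [h, Ideal.mem_span_singleton'] at this
    obtain ⟨a, ha⟩ := this
    refine ⟨a, ha.symm, ?_⟩
    rw [Submodule.mem_comap, key a w ha.symm]
    exact N.sub_mem hw (N.smul_mem a hu)
  · rintro ⟨a, ha, hw⟩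
    rw [Submodule.mem_comap, key a w ha] at hw
    exact (Submodule.sub_mem_iff_left N (N.smul_mem a hu)).1 hw

theorem index_eq_comap_consZero_mul_map_proj (N : Submodule A (Fin (n + 1) → A)) :
    N.toAddSubgroup.index = (N.comap (consZero A n)).toAddSubgroup.index *
      (N.map (LinearMap.proj (R := A) (φ := fun _ : Fin (n + 1) => A) 0)).toAddSubgroup.index := by
  have h := index_eq_index_comap_add_index_map (consZero A n).toAddMonoidHom
    (LinearMap.proj (R := A) (φ := fun _ : Fin (n + 1) => A) 0).toAddMonoidHom
    (fun a => ⟨fun _ => a, rfl⟩) ?_ N.toAddSubgroup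
  · exact h
  · ext u
    rw [AddMonoidHom.mem_ker, AddMonoidHom.mem_range]
    constructor
    · intro h
      refine ⟨Fin.tail u, ?_⟩
      have h' : u 0 = 0 := h
      change (Fin.cons 0 (Fin.tail u) : Fin (n + 1) → A) = u
      rw [← h', Fin.cons_self_tail]
    · rintro ⟨v, rfl⟩
      rfl

end Extension

section ModuleZeta

variable {p : ℕ} [Fact p.Prime] {n : ℕ}

/-- A generator of an ideal of finite index. -/
def FinIndexIdeal.gen (I : FinIndexIdeal p) : R p := Submodule.IsPrincipal.generator I.1

theorem FinIndexIdeal.span_gen (I : FinIndexIdeal p) : Ideal.span {I.gen} = I.1 :=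
  Ideal.span_singleton_generator I.1

theorem FinIndexIdeal.gen_ne_zero (I : FinIndexIdeal p) : I.gen ≠ 0 := by
  intro h
  refine ne_bot_of_index_ne_zero I.2 ?_
  rw [← I.span_gen, h, Ideal.span_singleton_eq_bot.2 rfl]

theorem idx_extend (I : FinIndexIdeal p) (M : Submodule (R p) (Rn p n)) (v : Rn p n) :
    idx (p := p) (n := n + 1) (extend I.gen M v) = idx M * I.1.toAddSubgroup.index := by
  rw [idx, index_eq_comap_consZero_mul_map_proj, comap_consZero_extend I.gen_ne_zero,
    map_proj_extend, I.span_gen, idx]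

/-- The submodule of `Rⁿ⁺¹` attached to an ideal `I`, a submodule `M` of `Rⁿ` and a class
modulo `M`. -/
def extendMap (x : Σ y : FinIndexIdeal p × FinIndexSubmodule p n, Rn p n ⧸ y.2.1) :
    FinIndexSubmodule p (n + 1) :=
  ⟨extend x.1.1.gen x.1.2.1 x.2.out, by
    rw [idx_extend]
    exact mul_ne_zero x.1.2.2 x.1.1.2⟩

theorem extendMap_bijective : Function.Bijective (extendMap (p := p) (n := n)) := by
  constructor
  · rintro ⟨⟨I, M⟩, v⟩ ⟨⟨J, N⟩, w⟩ h
    have h : extend I.gen M.1 v.out = extend J.gen N.1 w.out := congrArg Subtype.val h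
    obtain rfl : I = J := Subtype.ext <| by
      rw [← I.span_gen, ← J.span_gen, ← map_proj_extend I.gen M.1 v.out, h, map_proj_extend]
    obtain rfl : M = N := Subtype.ext <| by
      rw [← comap_consZero_extend I.gen_ne_zero M.1 v.out, h,
        comap_consZero_extend I.gen_ne_zero]
    have h' := sub_mem_of_extend_eq I.gen_ne_zero h
    rw [← Submodule.Quotient.eq] at h'
    have hv : v = w := by
      rw [← Quotient.out_eq' v, ← Quotient.out_eq' w]
      exact h'
    rw [hv]
  · rintro ⟨N, hN⟩
    have hN' := hN
    rw [idx, index_eq_comap_consZero_mul_map_proj] at hN'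
    let I : FinIndexIdeal p := ⟨_, right_ne_zero_of_mul hN'⟩
    let M : FinIndexSubmodule p n := ⟨_, left_ne_zero_of_mul hN'⟩
    obtain ⟨v, hv⟩ := exists_eq_extend N I.span_gen.symm
    refine ⟨⟨(I, M), Submodule.Quotient.mk v⟩, Subtype.ext ?_⟩
    refine Eq.trans (extend_congr ?_) hv.symm
    rw [← Submodule.Quotient.eq]
    exact Quotient.out_eq' _

theorem finite_quotient_of_idx_ne_zero {M : Submodule (R p) (Rn p n)} (h : idx M ≠ 0) :
    Finite (Rn p n ⧸ M) :=
  Nat.finite_of_card_ne_zero h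

theorem natCard_quotient (M : Submodule (R p) (Rn p n)) : Nat.card (Rn p n ⧸ M) = idx M := rfl

theorem prime_cpow_ne {z : ℂ} {n : ℕ} (hz : (n : ℝ) < z.re) : (p : ℂ) ^ z ≠ (p : ℂ) ^ n := by
  intro h
  have h' := congrArg norm h
  rw [norm_prime_cpow, norm_pow, Complex.norm_natCast, ← Real.rpow_natCast] at h'
  exact (Real.rpow_lt_rpow_of_exponent_lt one_lt_natCast_prime hz).ne' h'

theorem hasSum_moduleZeta (n : ℕ) {z : ℂ} (hz : (n : ℝ) < z.re) :
    HasSum (fun M : FinIndexSubmodule p n => (idx M.1 : ℂ) ^ (-z))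
      (((p : ℂ) ^ z - 1) / ((p : ℂ) ^ z - (p : ℂ) ^ n)) := by
  induction n generalizing z with
  | zero =>
    have htop : idx (⊤ : Submodule (R p) (Rn p 0)) = 1 := by
      rw [idx, Submodule.top_toAddSubgroup, AddSubgroup.index_top]
    let t : FinIndexSubmodule p 0 := ⟨⊤, by rw [htop]; exact one_ne_zero⟩
    have hu (M : FinIndexSubmodule p 0) : M = t := Subtype.ext (Subsingleton.elim _ _)
    have h := hasSum_single (f := fun M : FinIndexSubmodule p 0 => (idx M.1 : ℂ) ^ (-z)) t
      fun M hM => absurd (hu M) hM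
    have h1 : ((p : ℂ) ^ z - 1) / ((p : ℂ) ^ z - (p : ℂ) ^ 0) = (idx t.1 : ℂ) ^ (-z) := by
      have := prime_cpow_ne (p := p) hz
      rw [show idx t.1 = 1 from htop, Nat.cast_one, Complex.one_cpow]
      rw [pow_zero] at this ⊢
      exact div_self (sub_ne_zero.2 this)
    rwa [h1]
  | succ n ih =>
    push_cast at hz
    have hn : (0 : ℝ) ≤ n := n.cast_nonneg
    have h1 := hasSum_finIndexIdeal (p := p) (z := z) (by linarith)
    have h2 := ih (z := z - 1) (by rw [Complex.sub_re, Complex.one_re]; linarith)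
    have h3 := hasSum_mul_prod h1 h2
    rw [← (Equiv.ofBijective _ extendMap_bijective).hasSum_iff]
    have (y : FinIndexIdeal p × FinIndexSubmodule p n) : Finite (Rn p n ⧸ y.2.1) :=
      finite_quotient_of_idx_ne_zero y.2.2
    have h4 := (hasSum_sigma_const_iff
      (β := fun y : FinIndexIdeal p × FinIndexSubmodule p n => Rn p n ⧸ y.2.1)
      (fun y => ((idx y.2.1 * y.1.1.toAddSubgroup.index : ℕ) : ℂ) ^ (-z))
      (((p : ℂ) ^ z - 1) / ((p : ℂ) ^ z - (p : ℂ) ^ (n + 1)))).2 ?_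
    · convert h4 using 1
      funext x
      simp only [Function.comp_apply, Equiv.ofBijective_apply, extendMap]
      rw [idx_extend]
    · convert h3 using 1
      · funext y
        have h0 : (idx y.2.1 : ℂ) ≠ 0 := by exact_mod_cast y.2.2
        rw [natCard_quotient, Nat.cast_mul, Complex.natCast_mul_natCast_cpow, neg_sub,
          sub_eq_add_neg, Complex.cpow_add _ _ h0, Complex.cpow_one]
        ring
      · have hp := natCast_prime_ne_zero (p := p)
        have e1 : (p : ℂ) ^ z - p ≠ 0 := by
          have := prime_cpow_ne (p := p) (n := 1) (z := z) (by push_cast; linarith)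
          rw [pow_one] at this
          exact sub_ne_zero.2 this
        have e2 : (p : ℂ) ^ z - (p : ℂ) ^ (n + 1) ≠ 0 :=
          sub_ne_zero.2 (prime_cpow_ne (by push_cast; exact hz))
        have e3 : (p : ℂ) ^ (z - 1) = (p : ℂ) ^ z / p := by
          rw [Complex.cpow_sub _ _ hp, Complex.cpow_one]
        have e4 : (p : ℂ) ^ z / p - (p : ℂ) ^ n = ((p : ℂ) ^ z - (p : ℂ) ^ (n + 1)) / p := by
          field_simp
          ring
        have e5 : (p : ℂ) ^ z / p - 1 = ((p : ℂ) ^ z - p) / p := by field_simp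
        rw [e3, e4, e5]
        field_simp

end ModuleZeta

section Coordinates

variable {p n : ℕ}

/-- The identification of the base group with `Rⁿ`. -/
def baseEquiv : Base p n ≃+ Rn p n where
  toFun v i := .ofCoeff (v.mapRange (fun w => w i) rfl)
  invFun u := Finsupp.onFinset (Finset.univ.biUnion fun i => (u i).coeff.support)
    (fun j i => (u i).coeff j) fun j hj => by
      obtain ⟨i, hi⟩ := Function.ne_iff.1 hj
      exact Finset.mem_biUnion.2 ⟨i, Finset.mem_univ i, Finsupp.mem_support_iff.2 hi⟩
  left_inv v := by
    ext j i
    rfl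
  right_inv u := by
    funext i
    apply LaurentPolynomial.ext
    intro j
    rfl
  map_add' v w := by
    funext i
    apply LaurentPolynomial.ext
    intro j
    rfl

theorem coeff_baseEquiv (v : Base p n) (i : Fin n) (j : ℤ) :
    (baseEquiv v i).coeff j = v j i := rfl

theorem baseEquiv_shift (v : Base p n) :
    baseEquiv (shift p n v) = (T 1 : R p) • baseEquiv v := by
  funext i
  apply LaurentPolynomial.ext
  intro j
  rw [coeff_baseEquiv, Pi.smul_apply, smul_eq_mul, T, AddMonoidAlgebra.coeff_single_mul_apply,
    one_mul, coeff_baseEquiv]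
  change v (j + -1) i = v (-1 + j) i
  rw [add_comm]

theorem baseEquiv_shiftAction (m : Multiplicative ℤ) (a : Multiplicative (Base p n)) :
    baseEquiv (shiftAction p n m a).toAdd = (T m.toAdd : R p) • baseEquiv a.toAdd := by
  have hone (a : Multiplicative (Base p n)) :
      baseEquiv (AddEquiv.toMultiplicative (shift p n) a).toAdd =
        (T 1 : R p) • baseEquiv a.toAdd := baseEquiv_shift a.toAdd
  rw [shiftAction, zpowersHom_apply]
  generalize m.toAdd = k
  induction k generalizing a with
  | zero => simp
  | succ k ih =>
    rw [zpow_add_one, MulAut.mul_apply, ih, hone, smul_smul, T_add]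
  | pred k ih =>
    rw [zpow_sub_one, MulAut.mul_apply, ih]
    set b := (AddEquiv.toMultiplicative (shift p n) : MulAut (Multiplicative (Base p n)))⁻¹ a
      with hb
    have ha : a = AddEquiv.toMultiplicative (shift p n) b := by
      rw [hb]
      exact (MulAut.apply_inv_self _ _ _).symm
    rw [ha, hone, smul_smul, ← T_add, sub_add_cancel]

/-- The component of an element of the wreath product in `Rⁿ`. -/
def pos (g : L p n) : Rn p n := baseEquiv g.left.toAdd

/-- The component of an element of the wreath product in `ℤ`. -/
def deg (g : L p n) : ℤ := g.right.toAdd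

/-- The element of the wreath product with given components. -/
def mk (v : Rn p n) (k : ℤ) : L p n := ⟨.ofAdd (baseEquiv.symm v), .ofAdd k⟩

@[simp] theorem pos_mk (v : Rn p n) (k : ℤ) : pos (mk v k) = v := baseEquiv.apply_symm_apply v

@[simp] theorem deg_mk (v : Rn p n) (k : ℤ) : deg (mk v k) = k := rfl

theorem ext_pos_deg {g h : L p n} (h₁ : pos g = pos h) (h₂ : deg g = deg h) : g = h :=
  SemidirectProduct.ext (baseEquiv.injective h₁) h₂

@[simp] theorem deg_mul (g h : L p n) : deg (g * h) = deg g + deg h := rfl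

@[simp] theorem deg_one : deg (1 : L p n) = 0 := rfl

@[simp] theorem deg_inv (g : L p n) : deg g⁻¹ = -deg g := rfl

@[simp] theorem pos_mul (g h : L p n) : pos (g * h) = pos g + (T (deg g) : R p) • pos h := by
  simp only [pos, SemidirectProduct.mul_left, toAdd_mul, map_add]
  rw [baseEquiv_shiftAction]
  rfl

@[simp] theorem pos_one : pos (1 : L p n) = 0 := map_zero baseEquiv

@[simp] theorem pos_inv (g : L p n) : pos g⁻¹ = -((T (-deg g) : R p) • pos g) := by
  have h := pos_mul g⁻¹ g
  rw [inv_mul_cancel, pos_one, deg_inv] at h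
  exact eq_neg_of_add_eq_zero_left h.symm

theorem deg_zpow (g : L p n) (k : ℤ) : deg (g ^ k) = k * deg g := by
  have := map_zpow (SemidirectProduct.rightHom : L p n →* Multiplicative ℤ) g k
  have := congrArg Multiplicative.toAdd this
  rw [toAdd_zpow, smul_eq_mul] at this
  exact this

variable (p n) in
/-- The inclusion of `Rⁿ` into the wreath product. -/
def baseHom : Multiplicative (Rn p n) →* L p n where
  toFun v := mk v.toAdd 0
  map_one' := ext_pos_deg (by simp) (by simp)
  map_mul' v w := ext_pos_deg (by simp) (by simp)

variable (p n) in
/-- The projection of the wreath product onto `ℤ`. -/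
def degHom : L p n →* Multiplicative ℤ where
  toFun g := .ofAdd (deg g)
  map_one' := rfl
  map_mul' _ _ := rfl

theorem degHom_surjective : Function.Surjective (degHom p n) := fun k => ⟨mk 0 k.toAdd, rfl⟩

theorem ker_degHom : (degHom p n).ker = (baseHom p n).range := by
  ext g
  rw [MonoidHom.mem_ker, MonoidHom.mem_range]
  constructor
  · intro h
    have h : deg g = 0 := h
    exact ⟨.ofAdd (pos g), ext_pos_deg (by simp [baseHom]) (by simp [baseHom, h])⟩
  · rintro ⟨v, rfl⟩
    rfl

end Coordinates

section NormalSubgroups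

variable {p n : ℕ}

theorem one_sub_T_dvd (a k : ℤ) : (1 - T a : R p) ∣ 1 - T (a * k) := by
  have key (k : ℕ) : (1 - T a : R p) ∣ 1 - T (a * k) := by
    rw [mul_comm a, ← T_pow]
    exact one_sub_dvd_one_sub_pow _ _
  obtain ⟨k, rfl | rfl⟩ := k.eq_nat_or_neg
  · exact key k
  · refine (key k).trans ⟨-T (-(a * k)), ?_⟩
    rw [mul_neg, mul_neg, sub_mul, ← T_add]
    simp

theorem T_smul_sub_mem {M : Submodule (R p) (Rn p n)} {w : Rn p n} {a : ℤ}
    (h : (1 - T a : R p) • w ∈ M) (k : ℤ) : (T (a * k) : R p) • w - w ∈ M := by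
  obtain ⟨c, hc⟩ := one_sub_T_dvd (p := p) a k
  have : (T (a * k) : R p) • w - w = -(c • (1 - T a : R p) • w) := by
    rw [smul_smul, mul_comm c, ← hc]
    module
  rw [this]
  exact M.neg_mem (M.smul_mem c h)

/-- The subgroup attached to `s`, a submodule `M` containing `(1 - x ^ s) Rⁿ` and a vector
`v`; it is normal when `x` fixes `v` modulo `M`. -/
def datumSubgroup (s : ℤ) (M : Submodule (R p) (Rn p n))
    (hM : ∀ w : Rn p n, (1 - T s : R p) • w ∈ M) (v : Rn p n) :
    Subgroup (L p n) where
  carrier := {g | ∃ k : ℤ, deg g = s * k ∧ pos g - k • v ∈ M}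
  one_mem' := ⟨0, by simp, by simp⟩
  mul_mem' := by
    rintro g h ⟨k, hk, hg⟩ ⟨l, hl, hh⟩
    refine ⟨k + l, by rw [deg_mul, hk, hl]; ring, ?_⟩
    have : pos (g * h) - (k + l) • v =
        (pos g - k • v) + ((T (s * k) : R p) • pos h - pos h) + (pos h - l • v) := by
      rw [pos_mul, hk]
      module
    rw [this]
    exact M.add_mem (M.add_mem hg (T_smul_sub_mem (hM _) k)) hh
  inv_mem' := by
    rintro g ⟨k, hk, hg⟩
    refine ⟨-k, by rw [deg_inv, hk]; ring, ?_⟩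
    have : pos g⁻¹ - (-k) • v =
        -(((T (s * -k) : R p) • pos g - pos g) + (pos g - k • v)) := by
      rw [pos_inv, hk, mul_neg]
      module
    rw [this]
    exact M.neg_mem (M.add_mem (T_smul_sub_mem (hM _) (-k)) hg)

variable {s : ℤ} {M : Submodule (R p) (Rn p n)} {hM : ∀ w : Rn p n, (1 - T s : R p) • w ∈ M}
  {v : Rn p n}

theorem mem_datumSubgroup {g : L p n} :
    g ∈ datumSubgroup s M hM v ↔ ∃ k : ℤ, deg g = s * k ∧ pos g - k • v ∈ M := Iff.rfl

theorem mk_mem_datumSubgroup : mk v s ∈ datumSubgroup s M hM v :=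
  ⟨1, by simp, by simp⟩

theorem datumSubgroup_normal (hv : (1 - T 1 : R p) • v ∈ M) : (datumSubgroup s M hM v).Normal := by
  refine ⟨fun g ⟨k, hk, hg⟩ c => ⟨k, by simp [hk], ?_⟩⟩
  have : pos (c * g * c⁻¹) - k • v = (T (deg c) : R p) • (pos g - k • v) +
      k • ((T (1 * deg c) : R p) • v - v) - ((T (s * k) : R p) • pos c - pos c) := by
    simp only [pos_mul, deg_mul, pos_inv, smul_neg, smul_smul, ← T_add, hk]
    have e : deg c + s * k + -deg c = s * k := by ring
    rw [e, one_mul]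
    have e2 : (T (deg c) : R p) • (pos g - k • v) =
        (T (deg c) : R p) • pos g - k • (T (deg c) : R p) • v := by
      rw [smul_sub, smul_comm]
    rw [e2]
    module
  rw [this]
  exact M.sub_mem (M.add_mem (M.smul_mem _ hg) (zsmul_mem (T_smul_sub_mem hv _) _))
    (T_smul_sub_mem (hM _) _)

theorem comap_baseHom_datumSubgroup (hs : s ≠ 0) :
    (datumSubgroup s M hM v).comap (baseHom p n) = M.toAddSubgroup.toSubgroup := by
  ext w
  rw [Subgroup.mem_comap, mem_datumSubgroup]
  constructor
  · rintro ⟨k, hk, h⟩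
    have hk : 0 = s * k := hk
    have : k = 0 := by simpa [hs] using hk.symm
    rw [this, zero_smul, sub_zero] at h
    rw [show pos (baseHom p n w) = w.toAdd from pos_mk _ _] at h
    exact h
  · intro h
    refine ⟨0, by simp [baseHom], ?_⟩
    rw [zero_smul, sub_zero, show pos (baseHom p n w) = w.toAdd from pos_mk _ _]
    exact h

theorem map_degHom_datumSubgroup :
    (datumSubgroup s M hM v).map (degHom p n) = (AddSubgroup.zmultiples s).toSubgroup := by
  ext k
  rw [Subgroup.mem_map]
  constructor
  · rintro ⟨g, ⟨l, hl, -⟩, rfl⟩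
    exact Int.mem_zmultiples_iff.2 ⟨l, hl⟩
  · intro h
    obtain ⟨l, hl⟩ := Int.mem_zmultiples_iff.1 (show k.toAdd ∈ AddSubgroup.zmultiples s from h)
    refine ⟨mk (l • v) k.toAdd, ⟨l, by simp [hl], by simp⟩, rfl⟩

theorem index_eq_comap_baseHom_mul_map_degHom (N : Subgroup (L p n)) [N.Normal] :
    N.index = (N.comap (baseHom p n)).index * (N.map (degHom p n)).index :=
  index_eq_index_comap_mul_index_map _ _ degHom_surjective ker_degHom N

theorem index_datumSubgroup (hs : s ≠ 0) (hv : (1 - T 1 : R p) • v ∈ M) :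
    (datumSubgroup s M hM v).index = idx M * s.natAbs := by
  have := datumSubgroup_normal (hM := hM) hv
  rw [index_eq_comap_baseHom_mul_map_degHom, comap_baseHom_datumSubgroup hs,
    map_degHom_datumSubgroup, AddSubgroup.index_toSubgroup, AddSubgroup.index_toSubgroup,
    Int.index_zmultiples, idx]

theorem T_smul_mem_of_normal {N : Subgroup (L p n)} (hN : N.Normal) {w : Rn p n}
    (hw : mk w 0 ∈ N) (k : ℤ) : mk ((T k : R p) • w) 0 ∈ N := by
  convert hN.conj_mem _ hw (mk 0 k) using 1
  exact ext_pos_deg (by simp) (by simp)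

/-- The submodule of `Rⁿ` cut out by a normal subgroup. -/
def traceSubmodule [NeZero p] (N : Subgroup (L p n)) (hN : N.Normal) :
    Submodule (R p) (Rn p n) where
  carrier := {w | mk w 0 ∈ N}
  zero_mem' := by
    have h : mk (0 : Rn p n) 0 = 1 := ext_pos_deg (by simp) (by simp)
    rw [Set.mem_ofPred_eq, h]
    exact N.one_mem
  add_mem' {v w} hv hw := (N.comap (baseHom p n)).mul_mem hv hw
  smul_mem' r w hw := by
    induction r using LaurentPolynomial.induction_on' with
    | add r r' h h' =>
      rw [add_smul]
      exact (N.comap (baseHom p n)).mul_mem h h'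
    | C_mul_T k a =>
      rw [mul_smul, ← ZMod.natCast_zmod_val a, map_natCast, Nat.cast_smul_eq_nsmul]
      exact (N.comap (baseHom p n)).pow_mem (T_smul_mem_of_normal hN hw k) a.val

theorem mem_traceSubmodule [NeZero p] {N : Subgroup (L p n)} {hN : N.Normal} {w : Rn p n} :
    w ∈ traceSubmodule N hN ↔ mk w 0 ∈ N := Iff.rfl

theorem mem_iff_sub_mem_traceSubmodule [NeZero p] {N : Subgroup (L p n)} {hN : N.Normal} {g h : L p n}
    (hh : h ∈ N) (hd : deg g = deg h) : g ∈ N ↔ pos g - pos h ∈ traceSubmodule N hN := by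
  rw [mem_traceSubmodule, ← N.mul_mem_cancel_right (N.inv_mem hh)]
  congr! 1
  refine ext_pos_deg ?_ (by simp [hd])
  simp only [pos_mul, pos_inv, hd, smul_neg, smul_smul, ← T_add, pos_mk]
  simp [sub_eq_add_neg]

theorem exists_eq_datumSubgroup [NeZero p] (N : Subgroup (L p n)) (hN : N.Normal)
    (hi : N.index ≠ 0) : ∃ (s : ℕ+) (M : Submodule (R p) (Rn p n))
      (hM : ∀ w : Rn p n, (1 - T (s : ℤ) : R p) • w ∈ M) (v : Rn p n),
      (1 - T 1 : R p) • v ∈ M ∧ N = datumSubgroup s M hM v := by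
  rw [index_eq_comap_baseHom_mul_map_degHom] at hi
  obtain ⟨a, ha⟩ := Int.subgroup_cyclic (Subgroup.toAddSubgroup' (N.map (degHom p n)))
  rw [← AddSubgroup.zmultiples_eq_closure, ← Int.zmultiples_natAbs] at ha
  have ha' : N.map (degHom p n) = (AddSubgroup.zmultiples (a.natAbs : ℤ)).toSubgroup := by
    rw [← ha]
    rfl
  have hpos : 0 < a.natAbs := by
    have := right_ne_zero_of_mul hi
    rw [ha', AddSubgroup.index_toSubgroup, Int.index_zmultiples, Int.natAbs_natCast] at this
    exact Nat.pos_of_ne_zero this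
  obtain ⟨s, hs⟩ : ∃ s : ℕ+, (s : ℕ) = a.natAbs := ⟨⟨a.natAbs, hpos⟩, rfl⟩
  rw [← hs] at ha'
  have hdeg {k : ℤ} : Multiplicative.ofAdd k ∈ N.map (degHom p n) ↔ (s : ℤ) ∣ k := by
    rw [ha']
    exact Int.mem_zmultiples_iff
  obtain ⟨g₀, hg₀, hd⟩ := hdeg.2 (dvd_refl (s : ℤ))
  have hd : deg g₀ = s := hd
  set M := traceSubmodule N hN with hMdef
  have hM (w : Rn p n) : (1 - T (s : ℤ) : R p) • w ∈ M := by
    have h := (mem_iff_sub_mem_traceSubmodule (hN := hN) hg₀ (by simp)).1 (hN.conj_mem _ hg₀ (mk w 0))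
    convert h using 1
    simp only [pos_mul, pos_mk, deg_mk, T_zero, one_smul, deg_mul, hd, pos_inv, neg_zero, zero_add]
    module
  have hv : (1 - T 1 : R p) • pos g₀ ∈ M := by
    have h := (mem_iff_sub_mem_traceSubmodule (hN := hN) hg₀ (by simp)).1 (hN.conj_mem _ hg₀ (mk 0 1))
    have e : (1 - T 1 : R p) • pos g₀ = -(pos (mk 0 1 * g₀ * (mk 0 1)⁻¹) - pos g₀) := by
      simp only [pos_mul, pos_mk, deg_mk, deg_mul, pos_inv, smul_zero, neg_zero, zero_add, add_zero]
      module
    rw [e]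
    exact M.neg_mem h
  refine ⟨s, M, hM, pos g₀, hv, Subgroup.ext fun g => ?_⟩
  have hpow (k : ℤ) : pos (g₀ ^ k) - k • pos g₀ ∈ M := by
    have h0 : g₀ ∈ datumSubgroup (s : ℤ) M hM (pos g₀) := ⟨1, by simp [hd], by simp⟩
    obtain ⟨l, hl, h⟩ := Subgroup.zpow_mem _ h0 k
    rw [deg_zpow, hd, mul_comm] at hl
    have : k = l := mul_left_cancel₀ (by simp) hl
    rwa [this] at h ⊢
  have key (k : ℤ) (hk : deg g = s * k) : g ∈ N ↔ pos g - k • pos g₀ ∈ M := by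
    rw [mem_iff_sub_mem_traceSubmodule (hN := hN) (N.zpow_mem hg₀ k) (by rw [hk, deg_zpow, hd, mul_comm]),
      ← hMdef, ← Submodule.add_mem_iff_left _ (hpow k), sub_add_sub_cancel]
  rw [mem_datumSubgroup]
  constructor
  · intro hg
    obtain ⟨k, hk⟩ := hdeg.1 ⟨g, hg, rfl⟩
    exact ⟨k, hk, (key k hk).1 hg⟩
  · rintro ⟨k, hk, h⟩
    exact (key k hk).2 h

end NormalSubgroups

section Over

variable {p : ℕ} {n : ℕ}

variable (n) in
/-- The submodules of `Rⁿ` that contain `f Rⁿ`. -/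
def Over (f : R p) : Set (Submodule (R p) (Rn p n)) := {M | ∀ v : Rn p n, f • v ∈ M}

theorem mem_over {f : R p} {M : Submodule (R p) (Rn p n)} :
    M ∈ Over n f ↔ ∀ v : Rn p n, f • v ∈ M := Iff.rfl

theorem idx_pi_span (f : R p) :
    idx (Submodule.pi Set.univ fun _ : Fin n => Ideal.span {f}) =
      (Ideal.span {f}).toAddSubgroup.index ^ n := by
  have h := Nat.card_congr (Submodule.quotientPi fun _ : Fin n => Ideal.span {f}).toEquiv
  rw [Nat.card_fun, Nat.card_fin] at h
  exact h

theorem pi_span_le_of_mem_over {f : R p} {M : Submodule (R p) (Rn p n)} (hM : M ∈ Over n f) :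
    (Submodule.pi Set.univ fun _ : Fin n => Ideal.span {f}) ≤ M := by
  intro v hv
  choose c hc using fun i => Ideal.mem_span_singleton'.1 (hv i (Set.mem_univ i))
  have : v = f • c := by
    funext i
    rw [Pi.smul_apply, smul_eq_mul, mul_comm, hc]
  rw [this]
  exact hM c

theorem idx_dvd_of_mem_over {f : R p} {M : Submodule (R p) (Rn p n)} (hM : M ∈ Over n f) :
    idx M ∣ (Ideal.span {f}).toAddSubgroup.index ^ n := by
  rw [← idx_pi_span]
  exact AddSubgroup.index_dvd_of_le (pi_span_le_of_mem_over hM)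

variable [Fact p.Prime]

theorem idx_ne_zero_of_mem_over {f : R p} (hf : f ≠ 0) {M : Submodule (R p) (Rn p n)}
    (hM : M ∈ Over n f) : idx M ≠ 0 :=
  ne_zero_of_dvd_ne_zero (pow_ne_zero _ (index_span_singleton_ne_zero hf)) (idx_dvd_of_mem_over hM)

theorem one_sub_T_ne_zero {s : ℕ} (hs : s ≠ 0) : (1 - T (s : ℤ) : R p) ≠ 0 := by
  intro h
  rw [sub_eq_zero, ← T_zero] at h
  have := congrArg LaurentPolynomial.degree h
  rw [LaurentPolynomial.degree_T, LaurentPolynomial.degree_T] at this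
  exact hs (by exact_mod_cast this.symm)

theorem index_span_one_sub_T : (Ideal.span {(1 - T 1 : R p)}).toAddSubgroup.index = p := by
  rw [← toLaurent_one_sub_X, index_span_toLaurent (by simp)]
  have : (1 - X : (ZMod p)[X]) = -(X - Polynomial.C 1) := by simp
  rw [this, natDegree_neg, natDegree_X_sub_C, pow_one]

theorem tau_le {M : Submodule (R p) (Rn p n)} (hM : idx M ≠ 0) : tau M ≤ p ^ n := by
  set φ := LinearMap.lsmul (R p) (Rn p n ⧸ M) (1 - T 1) with hφ
  have := finite_quotient_of_idx_ne_zero hM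
  have h1 := AddSubgroup.card_mul_index φ.toAddMonoidHom.ker
  rw [AddSubgroup.index_ker, ← AddSubgroup.card_mul_index φ.toAddMonoidHom.range, mul_comm] at h1
  have h2 : Nat.card φ.toAddMonoidHom.ker = φ.toAddMonoidHom.range.index :=
    mul_left_cancel₀ Nat.card_pos.ne' h1
  have h3 : ((LinearMap.range φ).comap M.mkQ).toAddSubgroup.index =
      φ.toAddMonoidHom.range.index :=
    AddSubgroup.index_comap_of_surjective (f := M.mkQ.toAddMonoidHom) φ.toAddMonoidHom.range
      M.mkQ_surjective
  have h4 : (LinearMap.range φ).comap M.mkQ ∈ Over n (1 - T 1 : R p) := fun v =>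
    ⟨M.mkQ v, by rw [map_smul]; rfl⟩
  have h5 := idx_dvd_of_mem_over h4
  rw [index_span_one_sub_T] at h5
  have h6 : tau M = φ.toAddMonoidHom.range.index := h2
  rw [h6, ← h3]
  exact Nat.le_of_dvd (pow_pos (Fact.out : p.Prime).pos n) h5

end Over

section NormalZeta

variable {p n : ℕ} [Fact p.Prime]

variable (p n) in
/-- The pairs `(s, M)` of a positive integer and a submodule `M` containing `(1 - x ^ s) Rⁿ`. -/
abbrev OverPow : Type := Σ s : ℕ+, {M : Submodule (R p) (Rn p n) // M ∈ Over n (1 - T ((s : ℕ) : ℤ))}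

theorem OverPow.idx_ne_zero (y : OverPow p n) : idx y.2.1 ≠ 0 :=
  idx_ne_zero_of_mem_over (one_sub_T_ne_zero y.1.ne_zero) y.2.2

/-- The fixed vectors of `x` in `Rⁿ / M`. -/
abbrev Fixed (M : Submodule (R p) (Rn p n)) : Type :=
  LinearMap.ker (LinearMap.lsmul (R p) (Rn p n ⧸ M) (1 - T 1))

theorem mk_mem_fixed {M : Submodule (R p) (Rn p n)} {v : Rn p n} :
    (Submodule.Quotient.mk v : Rn p n ⧸ M) ∈
      LinearMap.ker (LinearMap.lsmul (R p) (Rn p n ⧸ M) (1 - T 1)) ↔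
      (1 - T 1 : R p) • v ∈ M := by
  rw [LinearMap.mem_ker, LinearMap.lsmul_apply, ← Submodule.Quotient.mk_smul,
    Submodule.Quotient.mk_eq_zero]

theorem mk_out {M : Submodule (R p) (Rn p n)} (v : Rn p n ⧸ M) :
    (Submodule.Quotient.mk v.out : Rn p n ⧸ M) = v := Quotient.out_eq' v

theorem Fixed.out_mem {M : Submodule (R p) (Rn p n)} (v : Fixed M) :
    (1 - T 1 : R p) • v.1.out ∈ M := by
  rw [← mk_mem_fixed, mk_out]
  exact v.2

/-- The normal subgroup attached to a pair `(s, M)` and a fixed vector of `x` in `Rⁿ / M`. -/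
def normalOfDatum (x : Σ y : OverPow p n, Fixed y.2.1) : FinIndexNormal p n :=
  ⟨datumSubgroup _ x.1.2.1 (mem_over.1 x.1.2.2) x.2.1.out, datumSubgroup_normal x.2.out_mem, by
    rw [index_datumSubgroup (by simp) x.2.out_mem]
    exact mul_ne_zero x.1.idx_ne_zero (by simp)⟩

theorem index_normalOfDatum (x : Σ y : OverPow p n, Fixed y.2.1) :
    (normalOfDatum x).1.index = idx x.1.2.1 * x.1.1 := by
  rw [normalOfDatum, index_datumSubgroup (by simp) x.2.out_mem, Int.natAbs_natCast]

theorem datumSubgroup_congr {s : ℤ} {M : Submodule (R p) (Rn p n)}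
    {hM : ∀ w : Rn p n, (1 - T s : R p) • w ∈ M} {v w : Rn p n} (h : v - w ∈ M) :
    datumSubgroup s M hM v = datumSubgroup s M hM w := by
  ext g
  refine exists_congr fun k => and_congr_right fun _ => ?_
  rw [← Submodule.sub_mem_iff_left (x := pos g - k • w) M (zsmul_mem h k)]
  congr! 1
  module

theorem normalOfDatum_bijective : Function.Bijective (normalOfDatum (p := p) (n := n)) := by
  constructor
  · rintro ⟨⟨s, M, hM⟩, v⟩ ⟨⟨t, N, hN⟩, w⟩ h
    have h : datumSubgroup _ M (mem_over.1 hM) v.1.out =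
        datumSubgroup _ N (mem_over.1 hN) w.1.out :=
      congrArg Subtype.val h
    obtain rfl : s = t := by
      have h1 := congrArg (fun N => (N.map (degHom p n)).index) h
      simp only [map_degHom_datumSubgroup, AddSubgroup.index_toSubgroup, Int.index_zmultiples,
        Int.natAbs_natCast] at h1
      exact PNat.coe_injective h1
    obtain rfl : M = N := by
      have h1 := congrArg (fun N => N.comap (baseHom p n)) h
      simp only [comap_baseHom_datumSubgroup (show ((s : ℕ) : ℤ) ≠ 0 by simp)] at h1
      exact Submodule.toAddSubgroup_injective (AddSubgroup.toSubgroup.injective h1)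
    have hm : mk v.1.out ((s : ℕ) : ℤ) ∈
        datumSubgroup _ M (mem_over.1 hN) w.1.out :=
      h ▸ mk_mem_datumSubgroup
    obtain ⟨k, hk, hv⟩ := hm
    rw [deg_mk] at hk
    have hk1 : k = 1 := (mul_eq_left₀ (by simp)).1 hk.symm
    rw [hk1, one_smul, pos_mk, ← Submodule.Quotient.eq, mk_out, mk_out] at hv
    rw [Subtype.ext hv]
  · rintro ⟨N, hN, hi⟩
    obtain ⟨s, M, hM, v, hv, rfl⟩ := exists_eq_datumSubgroup N hN hi
    refine ⟨⟨⟨s, M, hM⟩, ⟨Submodule.Quotient.mk v, mk_mem_fixed.2 hv⟩⟩, Subtype.ext ?_⟩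
    refine datumSubgroup_congr (hM := hM) ?_
    rw [← Submodule.Quotient.eq, mk_out]

variable (p n) in
/-- The parametrization of the normal subgroups of finite index. -/
def normalEquiv : (Σ y : OverPow p n, Fixed y.2.1) ≃ FinIndexNormal p n :=
  Equiv.ofBijective _ normalOfDatum_bijective

instance (y : OverPow p n) : Finite (Fixed y.2.1) :=
  have := finite_quotient_of_idx_ne_zero y.idx_ne_zero
  Subtype.finite

theorem hasSum_normal_iff {z S : ℂ} :
    HasSum (fun N : FinIndexNormal p n => (N.1.index : ℂ) ^ (-z)) S ↔
      HasSum (fun y : OverPow p n => (tau y.2.1 : ℂ) * ((idx y.2.1 * y.1 : ℕ) : ℂ) ^ (-z)) S := by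
  rw [← (normalEquiv p n).hasSum_iff]
  refine Iff.trans (iff_of_eq ?_) (hasSum_sigma_const_iff (β := fun y : OverPow p n => Fixed y.2.1)
    (fun y => ((idx y.2.1 * y.1 : ℕ) : ℂ) ^ (-z)) S)
  congr 1
  funext x
  simp only [Function.comp_apply, normalEquiv, Equiv.ofBijective_apply, index_normalOfDatum]

theorem summable_pnat_cpow {z : ℂ} (hz : 1 < z.re) :
    Summable fun s : ℕ+ => ((s : ℕ) : ℂ) ^ (-z) := by
  have h := (Complex.summable_one_div_nat_cpow.2 hz).comp_injective PNat.coe_injective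
  refine h.congr fun s => ?_
  simp [Complex.cpow_neg]

theorem summable_normal (hn : 1 ≤ n) {z : ℂ} (hz : (n : ℝ) < z.re) :
    Summable fun N : FinIndexNormal p n => (N.1.index : ℂ) ^ (-z) := by
  have hn' : (1 : ℝ) ≤ n := by exact_mod_cast hn
  have h1 := (hasSum_mul_prod (summable_pnat_cpow (z := z) (by linarith)).hasSum
    (hasSum_moduleZeta (p := p) n hz)).summable.norm
  let j : OverPow p n → ℕ+ × FinIndexSubmodule p n := fun y => (y.1, ⟨y.2.1, y.idx_ne_zero⟩)
  have hj : Function.Injective j := by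
    rintro ⟨s, M, hM⟩ ⟨t, N, hN⟩ h
    obtain rfl : s = t := congrArg Prod.fst h
    obtain rfl : M = N := congrArg (fun x => x.2.1) h
    rfl
  have h2 := (h1.comp_injective hj).mul_left ((p : ℝ) ^ n)
  have h3 : Summable fun y : OverPow p n =>
      (tau y.2.1 : ℂ) * ((idx y.2.1 * y.1 : ℕ) : ℂ) ^ (-z) := by
    refine Summable.of_norm_bounded h2 fun y => ?_
    rw [norm_mul, Complex.norm_natCast, Nat.cast_mul, Complex.natCast_mul_natCast_cpow,
      mul_comm (_ ^ _)]
    refine mul_le_mul_of_nonneg_right ?_ (norm_nonneg _)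
    exact_mod_cast tau_le y.idx_ne_zero
  exact (hasSum_normal_iff.2 h3.hasSum).summable

end NormalZeta

section Coefficients

theorem natCast_cpow_ne_zero {k : ℕ} (hk : k ≠ 0) (z : ℂ) : (k : ℂ) ^ z ≠ 0 := by
  have : (k : ℂ) ≠ 0 := by exact_mod_cast hk
  simp [Complex.cpow_eq_zero_iff, this]

theorem finite_fiber_of_summable_cpow {ι : Type*} {ℓ : ι → ℕ} {z : ℂ}
    (h : Summable fun i => (ℓ i : ℂ) ^ (-z)) {k : ℕ} (hk : k ≠ 0) : {i | ℓ i = k}.Finite :=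
  finite_fiber_of_summable ℓ (fun k => (k : ℂ) ^ (-z)) h (natCast_cpow_ne_zero hk _)

theorem lseriesHasSum_of_hasSum {ι : Type*} {ℓ : ι → ℕ} (h0 : ∀ i, ℓ i ≠ 0) {c : ℕ → ℕ}
    (hc : ∀ k, k ≠ 0 → c k = {i | ℓ i = k}.ncard) {z S : ℂ}
    (h : HasSum (fun i => (ℓ i : ℂ) ^ (-z)) S) : LSeriesHasSum (fun m => (c m : ℂ)) z S := by
  have hz : {i | ℓ i = 0} = ∅ := Set.eq_empty_of_forall_notMem fun i hi => h0 i hi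
  have hfin (k : ℕ) : {i | ℓ i = k}.Finite := by
    rcases eq_or_ne k 0 with rfl | hk
    · rw [hz]
      exact Set.finite_empty
    · exact finite_fiber_of_summable_cpow h.summable hk
  have h1 := (hasSum_comp_iff ℓ (fun k => (k : ℂ) ^ (-z)) hfin).1 h
  refine (congrArg (HasSum · S) (funext fun k => ?_)).mpr h1
  rw [LSeries.term_def]
  split_ifs with hk
  · rw [hk, hz, Set.ncard_empty, Nat.cast_zero, zero_mul]
  · rw [hc k hk, Complex.cpow_neg, div_eq_mul_inv]

theorem finite_le_of_summable_cpow {ι : Type*} {ℓ : ι → ℕ} (h0 : ∀ i, ℓ i ≠ 0) {z : ℂ}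
    (h : Summable fun i => (ℓ i : ℂ) ^ (-z)) (m : ℕ) : {i | ℓ i ≤ m}.Finite := by
  have : {i | ℓ i ≤ m} = ⋃ k ∈ Set.Icc 1 m, {i | ℓ i = k} := by
    ext i
    simp [Nat.one_le_iff_ne_zero, h0]
  rw [this]
  exact (Set.finite_Icc 1 m).biUnion fun k hk =>
    finite_fiber_of_summable_cpow h (Nat.one_le_iff_ne_zero.1 hk.1)

theorem limsup_log_ncard_le {ι : Type*} {ℓ : ι → ℕ} (h0 : ∀ i, ℓ i ≠ 0) {i₀ : ι} (hi₀ : ℓ i₀ = 1)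
    {a : ℝ} (ha : 0 ≤ a) (h : ∀ z : ℂ, a < z.re → Summable fun i => (ℓ i : ℂ) ^ (-z)) :
    limsup (fun m : ℕ => ((Real.log ({i | ℓ i ≤ m}.ncard : ℝ) / Real.log (m : ℝ) : ℝ) : EReal))
      atTop ≤ (a : EReal) := by
  refine le_of_forall_gt_imp_ge_of_dense fun b hb => ?_
  rcases eq_or_ne b ⊤ with rfl | hb'
  · exact le_top
  lift b to ℝ using ⟨hb', ((EReal.bot_lt_coe a).trans hb).ne'⟩
  rw [EReal.coe_lt_coe_iff] at hb
  have hs := h (b : ℂ) (by simpa using hb)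
  have hsn : Summable fun i => (ℓ i : ℝ) ^ (-b) := by
    refine hs.norm.congr fun i => ?_
    rw [Complex.norm_natCast_cpow_of_pos (Nat.pos_of_ne_zero (h0 i)), Complex.neg_re,
      Complex.ofReal_re]
  set C := ∑' i, (ℓ i : ℝ) ^ (-b)
  have hbound (m : ℕ) (hm : 1 ≤ m) : ({i | ℓ i ≤ m}.ncard : ℝ) ≤ C * (m : ℝ) ^ b := by
    have hf := finite_le_of_summable_cpow h0 hs m
    have hm0 : (0 : ℝ) < m := by exact_mod_cast hm
    have h1 : ∑ _i ∈ hf.toFinset, (m : ℝ) ^ (-b) ≤ C := by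
      refine le_trans (Finset.sum_le_sum fun i hi => ?_)
        (hsn.sum_le_tsum hf.toFinset fun i _ => by positivity)
      have hi : ℓ i ≤ m := by simpa using hi
      have hi0 : (0 : ℝ) < ℓ i := by exact_mod_cast Nat.pos_of_ne_zero (h0 i)
      exact Real.rpow_le_rpow_of_nonpos hi0 (by exact_mod_cast hi) (by linarith)
    rw [Finset.sum_const, nsmul_eq_mul, ← Set.ncard_eq_toFinset_card _ hf, Real.rpow_neg hm0.le,
      ← div_eq_mul_inv, div_le_iff₀ (by positivity)] at h1
    exact h1
  have hone (m : ℕ) (hm : 1 ≤ m) : (1 : ℝ) ≤ {i | ℓ i ≤ m}.ncard := by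
    have : 0 < {i | ℓ i ≤ m}.ncard :=
      (Set.ncard_pos (finite_le_of_summable_cpow h0 hs m)).2 ⟨i₀, hi₀.trans_le hm⟩
    exact_mod_cast this
  have hC : 0 < C := by
    have h1 := (hone 1 le_rfl).trans (hbound 1 le_rfl)
    rw [Nat.cast_one, Real.one_rpow, mul_one] at h1
    linarith
  have hlim : Tendsto (fun m : ℕ => ((Real.log C / Real.log (m : ℝ) + b : ℝ) : EReal)) atTop
      (nhds (b : EReal)) := by
    refine (continuous_coe_real_ereal.tendsto b).comp ?_
    have h1 : Tendsto (fun m : ℕ => Real.log C / Real.log (m : ℝ)) atTop (nhds 0) :=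
      tendsto_const_nhds.div_atTop (Real.tendsto_log_atTop.comp tendsto_natCast_atTop_atTop)
    simpa using h1.add_const b
  rw [← hlim.limsup_eq]
  refine limsup_le_limsup ?_
  filter_upwards [eventually_ge_atTop 2] with m hm
  rw [EReal.coe_le_coe_iff]
  have hm1 : (1 : ℝ) < m := by exact_mod_cast hm
  have hlog : 0 < Real.log m := Real.log_pos hm1
  have hm2 : 1 ≤ m := by omega
  rw [div_add' _ _ _ hlog.ne', div_le_div_iff_of_pos_right hlog,
    ← Real.log_rpow (by linarith), ← Real.log_mul hC.ne' (by positivity)]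
  exact Real.log_le_log (by linarith [hone m hm2]) (hbound m hm2)

end Coefficients

section Counting

variable {p n : ℕ}

theorem normalCount_eq {m : ℕ} (hm : m ≠ 0) :
    normalCount p n m = {N : FinIndexNormal p n | N.1.index = m}.ncard := by
  have h : {N : Subgroup (L p n) | N.Normal ∧ N.index = m} =
      Subtype.val '' {N : FinIndexNormal p n | N.1.index = m} := by
    ext N
    constructor
    · rintro ⟨h1, h2⟩
      exact ⟨⟨N, h1, h2 ▸ hm⟩, h2, rfl⟩
    · rintro ⟨N, h, rfl⟩
      exact ⟨N.2.1, h⟩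
  change (if m = 0 then 0 else _) = _
  rw [if_neg hm, h, Set.ncard_image_of_injective _ Subtype.val_injective]

theorem submoduleCount_eq {m : ℕ} (hm : m ≠ 0) :
    submoduleCount p n m = {M : Submodule (R p) (Rn p n) | idx M = m}.ncard :=
  if_neg hm

theorem ncard_finIndexSubmodule {m : ℕ} (hm : m ≠ 0) :
    {M : FinIndexSubmodule p n | idx M.1 = m}.ncard =
      {M : Submodule (R p) (Rn p n) | idx M = m}.ncard := by
  have h : {M : Submodule (R p) (Rn p n) | idx M = m} =
      Subtype.val '' {M : FinIndexSubmodule p n | idx M.1 = m} := by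
    ext M
    constructor
    · intro h
      exact ⟨⟨M, (show idx M = m from h) ▸ hm⟩, h, rfl⟩
    · rintro ⟨N, h, rfl⟩
      exact h
  rw [h, Set.ncard_image_of_injective _ Subtype.val_injective]

theorem ncard_normalUpTo (m : ℕ) :
    (normalUpTo p n m).ncard = {N : FinIndexNormal p n | N.1.index ≤ m}.ncard := by
  have h : normalUpTo p n m = Subtype.val '' {N : FinIndexNormal p n | N.1.index ≤ m} := by
    ext N
    constructor
    · rintro ⟨h1, h2, h3⟩
      exact ⟨⟨N, h1, h2⟩, h3, rfl⟩
    · rintro ⟨N, h, rfl⟩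
      exact ⟨N.2.1, N.2.2, h⟩
  rw [h, Set.ncard_image_of_injective _ Subtype.val_injective]

variable [Fact p.Prime]

variable (p n) in
theorem finite_idx_eq {m : ℕ} (hm : m ≠ 0) :
    {M : Submodule (R p) (Rn p n) | idx M = m}.Finite := by
  have h := (hasSum_moduleZeta (p := p) n (z := (n + 1 : ℝ)) (by simp)).summable
  refine ((finite_fiber_of_summable_cpow h hm).image Subtype.val).subset fun M hM => ?_
  exact ⟨⟨M, (show idx M = m from hM) ▸ hm⟩, hM, rfl⟩

variable (p) in
theorem finite_normalUpTo (hn : 1 ≤ n) (m : ℕ) : (normalUpTo p n m).Finite := by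
  have h := summable_normal (p := p) hn (z := (n + 1 : ℝ)) (by simp)
  refine ((finite_le_of_summable_cpow (fun N => N.2.2) h m).image Subtype.val).subset fun N hN => ?_
  exact ⟨⟨N, hN.1, hN.2.1⟩, hN.2.2, rfl⟩

theorem normalCount_le {m : ℕ} (hm : m ≠ 0) :
    normalCount p n m ≤ p ^ n * ∑ d ∈ m.divisors, submoduleCount p n d := by
  let A := {y : OverPow p n // idx y.2.1 * y.1 = m}
  have hfin (d : m.divisors) : Finite {M : Submodule (R p) (Rn p n) // idx M = d} :=
    finite_idx_eq p n (Nat.pos_of_mem_divisors d.2).ne'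
  let j : A → Σ d : m.divisors, {M : Submodule (R p) (Rn p n) // idx M = d} := fun y =>
    ⟨⟨idx y.1.2.1, Nat.mem_divisors.2 ⟨⟨y.1.1, y.2.symm⟩, hm⟩⟩, ⟨y.1.2.1, rfl⟩⟩
  have hj : Function.Injective j := by
    rintro ⟨⟨s, M, hM⟩, h⟩ ⟨⟨t, N, hN⟩, h'⟩ he
    obtain rfl : M = N := congrArg (fun x => x.2.1) he
    obtain rfl : s = t := PNat.coe_injective <|
      mul_left_cancel₀ (OverPow.idx_ne_zero ⟨s, M, hM⟩) (h.trans h'.symm)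
    rfl
  have hA : Finite A := Finite.of_injective j hj
  have hAf := Fintype.ofFinite A
  have e : {N : FinIndexNormal p n | N.1.index = m} ≃ Σ y : A, Fixed y.1.2.1 :=
    (((normalEquiv p n).subtypeEquiv fun x => by
      rw [← index_normalOfDatum]; rfl).symm).trans
      (Equiv.subtypeSigmaEquiv (fun y : OverPow p n => Fixed y.2.1)
        fun y => idx y.2.1 * y.1 = m)
  calc normalCount p n m = Nat.card (Σ y : A, Fixed y.1.2.1) := by
        rw [normalCount_eq hm, ← Nat.card_congr e]
        rfl
    _ = ∑ y : A, tau y.1.2.1 := Nat.card_sigma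
    _ ≤ ∑ _y : A, p ^ n := Finset.sum_le_sum fun y _ => tau_le y.1.idx_ne_zero
    _ = p ^ n * Nat.card A := by
        rw [Finset.sum_const, Finset.card_univ, ← Nat.card_eq_fintype_card, smul_eq_mul, mul_comm]
    _ ≤ p ^ n * Nat.card (Σ d : m.divisors, {M : Submodule (R p) (Rn p n) // idx M = d}) :=
        Nat.mul_le_mul_left _ (Nat.card_le_card_of_injective j hj)
    _ = p ^ n * ∑ d ∈ m.divisors, submoduleCount p n d := by
        rw [Nat.card_sigma, ← Finset.sum_coe_sort m.divisors]
        congr 1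
        refine Finset.sum_congr rfl fun d _ => ?_
        rw [submoduleCount_eq (Nat.pos_of_mem_divisors d.2).ne']
        rfl

end Counting

section CoprimeDecomposition

variable {p n : ℕ} {g h : R p} {M N : Submodule (R p) (Rn p n)}

theorem mem_of_isCoprime (hgh : IsCoprime g h) {v : Rn p n} (hg : g • v ∈ M) (hh : h • v ∈ M) :
    v ∈ M := by
  obtain ⟨a, b, hab⟩ := hgh
  have : v = a • g • v + b • h • v := by
    rw [smul_smul, smul_smul, ← add_smul, hab, one_smul]
  rw [this]
  exact M.add_mem (M.smul_mem a hg) (M.smul_mem b hh)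

theorem smul_mem_iff_of_isCoprime (hgh : IsCoprime g h) (hM : M ∈ Over n g) {v : Rn p n} :
    h • v ∈ M ↔ v ∈ M :=
  ⟨fun hv => mem_of_isCoprime hgh (hM v) hv, fun hv => M.smul_mem h hv⟩

theorem inf_mem_over (hM : M ∈ Over n g) (hN : N ∈ Over n h) : M ⊓ N ∈ Over n (g * h) := fun v =>
  ⟨by rw [mul_smul]; exact hM _, by rw [mul_comm, mul_smul]; exact hN _⟩

theorem comap_inf_left (hgh : IsCoprime g h) (hM : M ∈ Over n g) (hN : N ∈ Over n h) :
    (M ⊓ N).comap (LinearMap.lsmul (R p) (Rn p n) h) = M := by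
  ext v
  rw [Submodule.mem_comap, LinearMap.lsmul_apply, Submodule.mem_inf,
    smul_mem_iff_of_isCoprime hgh hM]
  exact and_iff_left (hN v)

theorem comap_inf_comap (hgh : IsCoprime g h) :
    M.comap (LinearMap.lsmul (R p) (Rn p n) h) ⊓ M.comap (LinearMap.lsmul (R p) (Rn p n) g) = M := by
  ext v
  rw [Submodule.mem_inf, Submodule.mem_comap, Submodule.mem_comap]
  exact ⟨fun hv => mem_of_isCoprime hgh hv.2 hv.1, fun hv => ⟨M.smul_mem h hv, M.smul_mem g hv⟩⟩

theorem comap_mem_over (hM : M ∈ Over n (h * g)) :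
    M.comap (LinearMap.lsmul (R p) (Rn p n) h) ∈ Over n g := fun v => by
  rw [Submodule.mem_comap, LinearMap.lsmul_apply, smul_smul]
  exact hM v

/-- The Chinese remainder theorem for quotients of `Rⁿ`. -/
def quotientInfEquiv (hgh : IsCoprime g h) (hM : M ∈ Over n g) (hN : N ∈ Over n h) :
    (Rn p n ⧸ M ⊓ N) ≃ₗ[R p] (Rn p n ⧸ M) × (Rn p n ⧸ N) :=
  (Submodule.quotEquivOfEq _ _ (by rw [LinearMap.ker_prod, M.ker_mkQ, N.ker_mkQ])).trans
    ((M.mkQ.prod N.mkQ).quotKerEquivOfSurjective (by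
      rintro ⟨x, y⟩
      obtain ⟨v, rfl⟩ := M.mkQ_surjective x
      obtain ⟨w, rfl⟩ := N.mkQ_surjective y
      obtain ⟨a, b, hab⟩ := hgh
      refine ⟨(b * h) • v + (a * g) • w, Prod.ext ?_ ?_⟩
      · refine (Submodule.Quotient.eq _).2 ?_
        have : (b * h) • v + (a * g) • w - v = a • g • (w - v) := by
          rw [← eq_sub_iff_add_eq'] at hab
          rw [hab]
          module
        rw [this]
        exact M.smul_mem a (hM _)
      · refine (Submodule.Quotient.eq _).2 ?_
        have : (b * h) • v + (a * g) • w - w = b • h • (v - w) := by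
          rw [← eq_sub_iff_add_eq] at hab
          rw [hab]
          module
        rw [this]
        exact N.smul_mem b (hN _)))

theorem idx_inf (hgh : IsCoprime g h) (hM : M ∈ Over n g) (hN : N ∈ Over n h) :
    idx (M ⊓ N) = idx M * idx N := by
  have := Nat.card_congr (quotientInfEquiv hgh hM hN).toEquiv
  rw [Nat.card_prod] at this
  exact this

theorem tau_inf (hgh : IsCoprime g h) (hM : M ∈ Over n g) (hN : N ∈ Over n h) :
    tau (M ⊓ N) = tau M * tau N := by
  rw [tau, tau, tau, ← Nat.card_prod]
  refine Nat.card_congr (((quotientInfEquiv hgh hM hN).toEquiv.subtypeEquiv fun x => ?_).trans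
    (Equiv.subtypeProdEquivProd
      (p := (· ∈ LinearMap.ker (LinearMap.lsmul (R p) (Rn p n ⧸ M) (1 - T 1))))
      (q := (· ∈ LinearMap.ker (LinearMap.lsmul (R p) (Rn p n ⧸ N) (1 - T 1))))))
  simp only [LinearMap.mem_ker, LinearMap.lsmul_apply]
  rw [← (quotientInfEquiv hgh hM hN).map_eq_zero_iff, map_smul, Prod.ext_iff]
  rfl

variable (n) in
theorem finite_over [Fact p.Prime] {f : R p} (hf : f ≠ 0) : (Over n f).Finite := by
  have hfin : ((Submodule.pi Set.univ fun _ : Fin n => Ideal.span {f} :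
      Submodule (R p) (Rn p n))) ∈ Over n f := fun v i _ =>
    Ideal.mul_mem_right _ _ (Ideal.mem_span_singleton_self f)
  set Q : Submodule (R p) (Rn p n) := Submodule.pi Set.univ fun _ : Fin n => Ideal.span {f}
  have := finite_quotient_of_idx_ne_zero (idx_ne_zero_of_mem_over hf hfin)
  have : Finite (Submodule (R p) (Rn p n ⧸ Q)) :=
    Finite.of_injective (fun M => (M : Set (Rn p n ⧸ Q))) SetLike.coe_injective
  refine (Set.finite_range (Submodule.comap Q.mkQ)).subset fun M hM => ⟨M.map Q.mkQ, ?_⟩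
  rw [Submodule.comap_map_mkQ, sup_eq_right]
  exact pi_span_le_of_mem_over hM

theorem finsum_over_mul [Fact p.Prime] (hgh : IsCoprime g h) (hg : g ≠ 0) (hh : h ≠ 0)
    {w : Submodule (R p) (Rn p n) → ℂ}
    (hw : ∀ M ∈ Over n g, ∀ N ∈ Over n h, w (M ⊓ N) = w M * w N) :
    ∑ᶠ M ∈ Over n (g * h), w M = (∑ᶠ M ∈ Over n g, w M) * ∑ᶠ M ∈ Over n h, w M := by
  rw [finsum_mem_eq_finite_toFinset_sum _ (finite_over n hg),
    finsum_mem_eq_finite_toFinset_sum _ (finite_over n hh),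
    finsum_mem_eq_finite_toFinset_sum _ (finite_over n (mul_ne_zero hg hh)),
    Finset.sum_mul_sum, ← Finset.sum_product']
  symm
  refine Finset.sum_bij' (fun x _ => x.1 ⊓ x.2)
    (fun M _ => (M.comap (LinearMap.lsmul (R p) (Rn p n) h),
      M.comap (LinearMap.lsmul (R p) (Rn p n) g))) ?_ ?_ ?_ ?_ ?_
  · intro x hx
    simp only [Finset.mem_product, Set.Finite.mem_toFinset] at hx ⊢
    exact inf_mem_over hx.1 hx.2
  · intro M hM
    simp only [Finset.mem_product, Set.Finite.mem_toFinset] at hM ⊢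
    exact ⟨comap_mem_over (mul_comm g h ▸ hM), comap_mem_over hM⟩
  · intro x hx
    simp only [Finset.mem_product, Set.Finite.mem_toFinset] at hx
    refine Prod.ext (comap_inf_left hgh hx.1 hx.2) ?_
    simp only
    rw [inf_comm]
    exact comap_inf_left hgh.symm hx.2 hx.1
  · intro M _
    exact comap_inf_comap hgh
  · intro x hx
    simp only [Finset.mem_product, Set.Finite.mem_toFinset] at hx
    exact (hw _ hx.1 _ hx.2).symm

end CoprimeDecomposition

section EulerProduct

variable {p n : ℕ}

/-- The prime divisors of `f`, normalized to be polynomials with constant term `1`. -/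
def normPrimes (f : R p) : Set (R p) :=
  {r | Prime r ∧ (∃ q : (ZMod p)[X], q.coeff 0 = 1 ∧ Polynomial.toLaurent q = r) ∧ r ∣ f}

variable (n) in
/-- The members `M` of `Mod_r` with `f Rⁿ ⊆ M`. -/
def PrimaryOver (r f : R p) : Set (Submodule (R p) (Rn p n)) := PrimaryMod p n r ∩ Over n f

theorem primaryOver_mul_right {r x y : R p} (hr : IsCoprime r y) :
    PrimaryOver n r (x * y) = PrimaryOver n r x := by
  ext M
  refine and_congr_right fun ⟨k, hk⟩ => ⟨fun hM v => ?_, fun hM v => ?_⟩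
  · refine mem_of_isCoprime (hr.pow_left (m := k)) (hk _) ?_
    rw [smul_smul, mul_comm]
    exact hM v
  · rw [mul_smul]
    exact hM _

variable [Fact p.Prime]

theorem eq_of_associated_of_mem_normPrimes {r r' f f' : R p} (h : r ∈ normPrimes f)
    (h' : r' ∈ normPrimes f') (ha : Associated r r') : r = r' := by
  obtain ⟨-, ⟨q, hq, rfl⟩, -⟩ := h
  obtain ⟨-, ⟨q', hq', rfl⟩, -⟩ := h'
  rw [eq_of_associated_toLaurent hq hq' ha]

theorem normPrimes_mul (x y : R p) : normPrimes (x * y) = normPrimes x ∪ normPrimes y := by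
  ext r
  constructor
  · rintro ⟨hp, hr, hd⟩
    exact (hp.dvd_or_dvd hd).imp (fun h => ⟨hp, hr, h⟩) (fun h => ⟨hp, hr, h⟩)
  · rintro (⟨hp, hr, hd⟩ | ⟨hp, hr, hd⟩)
    · exact ⟨hp, hr, hd.mul_right y⟩
    · exact ⟨hp, hr, hd.mul_left x⟩

/-- The Euler product for sums of multiplicative functions over the submodules that contain
`f Rⁿ`. -/
theorem finsum_over_eq_finprod {w : Submodule (R p) (Rn p n) → ℂ} (hw1 : w ⊤ = 1)
    (hw : ∀ g h : R p, IsCoprime g h → ∀ M ∈ Over n g, ∀ N ∈ Over n h, w (M ⊓ N) = w M * w N)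
    (f : R p) (hf : f ≠ 0) :
    (normPrimes f).Finite ∧
      ∑ᶠ M ∈ Over n f, w M = ∏ᶠ r ∈ normPrimes f, ∑ᶠ M ∈ PrimaryOver n r f, w M := by
  have hunit {x : R p} (hx : IsUnit x) : (normPrimes x).Finite ∧
      ∑ᶠ M ∈ Over n x, w M = ∏ᶠ r ∈ normPrimes x, ∑ᶠ M ∈ PrimaryOver n r x, w M := by
    have h1 : normPrimes x = ∅ := Set.eq_empty_of_forall_notMem fun r hr =>
      hr.1.not_isUnit (isUnit_of_dvd_unit hr.2.2 hx)
    have h2 : Over n x = {⊤} := by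
      ext M
      rw [Set.mem_singleton_iff]
      constructor
      · intro hM
        rw [eq_top_iff]
        intro v _
        obtain ⟨u, rfl⟩ := hx
        have := hM ((↑u⁻¹ : R p) • v)
        rwa [smul_smul, Units.mul_inv, one_smul] at this
      · rintro rfl v
        trivial
    rw [h1, h2]
    exact ⟨Set.finite_empty, by rw [finsum_mem_singleton, finprod_mem_empty, hw1]⟩
  induction f using UniqueFactorizationMonoid.induction_on_coprime with
  | h0 => exact absurd rfl hf
  | h1 hx => exact hunit hx
  | @hpr q i hq =>
    rcases Nat.eq_zero_or_pos i with rfl | hi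
    · exact hunit (by rw [pow_zero]; exact isUnit_one)
    · obtain ⟨r₀, hr₀, ha⟩ := exists_associated_toLaurent hq.ne_zero
      have hmem : toLaurent r₀ ∈ normPrimes (q ^ i) :=
        ⟨ha.symm.prime hq, ⟨r₀, hr₀, rfl⟩, ha.dvd.trans (dvd_pow_self q hi.ne')⟩
      have h1 : normPrimes (q ^ i) = {toLaurent r₀} := by
        refine Set.eq_singleton_iff_unique_mem.2 ⟨hmem, fun r hr => ?_⟩
        refine eq_of_associated_of_mem_normPrimes hr hmem ?_
        exact ((hr.1.dvd_prime_iff_associated hq).1 (hr.1.dvd_of_dvd_pow hr.2.2)).trans ha.symm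
      have h2 : PrimaryOver n (toLaurent r₀) (q ^ i) = Over n (q ^ i) := by
        refine Set.inter_eq_right.2 fun M hM => ⟨i, fun v => ?_⟩
        obtain ⟨c, hc⟩ := pow_dvd_pow_of_dvd ha.symm.dvd i
        rw [hc, mul_smul]
        exact hM _
      rw [h1]
      exact ⟨Set.finite_singleton _, by rw [finprod_mem_singleton, h2]⟩
  | @hcp x y hxy hx hy =>
    obtain ⟨hx1, hx2⟩ := hx (left_ne_zero_of_mul hf)
    obtain ⟨hy1, hy2⟩ := hy (right_ne_zero_of_mul hf)
    have hc : IsCoprime x y := hxy.isCoprime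
    rw [normPrimes_mul]
    refine ⟨hx1.union hy1, ?_⟩
    rw [finsum_over_mul hc (left_ne_zero_of_mul hf) (right_ne_zero_of_mul hf) (hw x y hc), hx2, hy2,
      finprod_mem_union _ hx1 hy1]
    · congr 1
      · refine finprod_mem_congr rfl fun r hr => ?_
        rw [primaryOver_mul_right (hc.of_isCoprime_of_dvd_left hr.2.2)]
      · refine finprod_mem_congr rfl fun r hr => ?_
        rw [mul_comm, primaryOver_mul_right (hc.symm.of_isCoprime_of_dvd_left hr.2.2)]
    · rw [Set.disjoint_left]
      intro r hrx hry
      exact hrx.1.not_isUnit (hc.isUnit_of_dvd' hrx.2.2 hry.2.2)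

theorem tau_eq_one {r : R p} (hr : IsCoprime r (1 - T 1)) {M : Submodule (R p) (Rn p n)}
    (hM : M ∈ PrimaryMod p n r) : tau M = 1 := by
  obtain ⟨k, hk⟩ := hM
  have h : LinearMap.ker (LinearMap.lsmul (R p) (Rn p n ⧸ M) (1 - T 1)) = ⊥ := by
    rw [eq_bot_iff]
    intro x hx
    obtain ⟨v, rfl⟩ := M.mkQ_surjective x
    rw [Submodule.mem_bot, Submodule.mkQ_apply, Submodule.Quotient.mk_eq_zero]
    exact mem_of_isCoprime (hr.pow_left (m := k)) (hk v) (mk_mem_fixed.1 hx)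
  rw [tau, h]
  exact Nat.card_unique

theorem one_sub_T_mem_normPrimes (s : ℕ) :
    (1 - T 1 : R p) ∈ normPrimes (1 - T (s : ℤ) : R p) := by
  refine ⟨prime_one_sub_T, ⟨1 - X, by simp, toLaurent_one_sub_X⟩, ?_⟩
  have := one_sub_T_dvd (p := p) 1 s
  rwa [one_mul] at this

theorem otherPrimes_eq (s : ℕ) :
    otherPrimes p s = normPrimes (1 - T (s : ℤ) : R p) \ {1 - T 1} := by
  ext r
  constructor
  · rintro ⟨h1, h2, h3, h4⟩
    exact ⟨⟨h1, h2, h3⟩, h4⟩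
  · rintro ⟨⟨h1, h2, h3⟩, h4⟩
    exact ⟨h1, h2, h3, h4⟩

theorem isCoprime_of_mem_otherPrimes {s : ℕ} {r : R p} (hr : r ∈ otherPrimes p s) :
    IsCoprime r (1 - T 1) := by
  rw [otherPrimes_eq] at hr
  rw [hr.1.1.irreducible.coprime_iff_not_dvd, hr.1.1.dvd_prime_iff_associated prime_one_sub_T]
  exact fun h => hr.2 (eq_of_associated_of_mem_normPrimes hr.1 (one_sub_T_mem_normPrimes s) h)

variable (p n) in
theorem finsum_over_one_sub_T {s : ℕ} (hs : s ≠ 0) (z : ℂ) :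
    ∑ᶠ M ∈ Over n (1 - T (s : ℤ) : R p), (tau M : ℂ) * (idx M : ℂ) ^ (-z) =
      (∏ᶠ r ∈ otherPrimes p s, localFactor p n r s z) * tauFactor p n s z := by
  obtain ⟨hfin, h⟩ := finsum_over_eq_finprod (n := n)
    (w := fun M => (tau M : ℂ) * (idx M : ℂ) ^ (-z))
    (by
      have h1 : tau (⊤ : Submodule (R p) (Rn p n)) = 1 := Nat.card_unique
      have h2 : idx (⊤ : Submodule (R p) (Rn p n)) = 1 := AddSubgroup.index_top
      rw [h1, h2, Nat.cast_one, Complex.one_cpow, one_mul])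
    (fun g h hgh M hM N hN => by
      rw [tau_inf hgh hM hN, idx_inf hgh hM hN, Nat.cast_mul, Nat.cast_mul,
        Complex.natCast_mul_natCast_cpow]
      ring)
    (1 - T (s : ℤ)) (one_sub_T_ne_zero hs)
  have hins : normPrimes (1 - T (s : ℤ) : R p) = insert (1 - T 1) (otherPrimes p s) := by
    rw [otherPrimes_eq, Set.insert_sdiff_singleton,
      Set.insert_eq_of_mem (one_sub_T_mem_normPrimes s)]
  rw [h, hins, finprod_mem_insert _ (by simp [otherPrimes])
    (hfin.subset (by rw [hins]; exact Set.subset_insert _ _)), mul_comm]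
  congr 1
  refine finprod_mem_congr rfl fun r hr => finsum_mem_congr rfl fun M hM => ?_
  rw [tau_eq_one (isCoprime_of_mem_otherPrimes hr) hM.1, Nat.cast_one, one_mul]

theorem hasSum_eulerProduct {z S : ℂ}
    (h : HasSum (fun N : FinIndexNormal p n => (N.1.index : ℂ) ^ (-z)) S) :
    HasSum (fun s : ℕ+ => ((s : ℕ) : ℂ) ^ (-z) *
      (∏ᶠ r ∈ otherPrimes p s, localFactor p n r s z) * tauFactor p n s z) S := by
  refine (hasSum_normal_iff.1 h).sigma fun s => ?_
  have hfin := (finite_over n (one_sub_T_ne_zero (p := p) s.ne_zero)).fintype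
  rw [mul_assoc, ← finsum_over_one_sub_T p n s.ne_zero, ← finsum_set_coe_eq_finsum_mem,
    finsum_eq_sum_of_fintype, Finset.mul_sum]
  have key := hasSum_fintype fun M : {M // M ∈ Over n (1 - T ((s : ℕ) : ℤ) : R p)} =>
    (tau M.1 : ℂ) * ((idx M.1 * s : ℕ) : ℂ) ^ (-z)
  refine (congrArg (HasSum _) (Finset.sum_congr rfl fun M _ => ?_)).mp key
  rw [Nat.cast_mul, Complex.natCast_mul_natCast_cpow]
  ring

end EulerProduct

end Lamplighter

end

theorem mainTheorem7 (p n : ℕ) [Fact p.Prime] (hn : 1 ≤ n) :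
    -- the two zeta functions converge absolutely for `re z > n` and have the expected coefficients
    (∀ m : ℕ, 1 ≤ m → {N : Subgroup (Lamplighter.L p n) | N.Normal ∧ N.index = m}.Finite) ∧
    (∀ m : ℕ, 1 ≤ m → {M : Submodule (Lamplighter.R p) (Lamplighter.Rn p n) |
      Lamplighter.idx M = m}.Finite) ∧
    (∀ z : ℂ, (n : ℝ) < z.re →
      Summable (fun N : Lamplighter.FinIndexNormal p n => (N.1.index : ℂ) ^ (-z)) ∧
      LSeriesHasSum (fun m => (Lamplighter.normalCount p n m : ℂ)) z
        (Lamplighter.normalZeta p n z)) ∧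
    -- the Euler-product-type formula, wherever the zeta function converges absolutely
    (∀ z : ℂ, Summable (fun N : Lamplighter.FinIndexNormal p n => (N.1.index : ℂ) ^ (-z)) →
      HasSum (fun s : ℕ+ => ((s : ℕ) : ℂ) ^ (-z) *
          (∏ᶠ r ∈ Lamplighter.otherPrimes p s, Lamplighter.localFactor p n r s z) *
          Lamplighter.tauFactor p n s z)
        (Lamplighter.normalZeta p n z)) ∧
    -- the coefficientwise bound by `p ^ n ζ(z) ξ_n(z)`
    (∀ m : ℕ, 1 ≤ m → Lamplighter.normalCount p n m ≤
      p ^ n * (ArithmeticFunction.zeta * Lamplighter.submoduleCount p n) m) ∧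
    -- the closed form of `ξ_n(z)`
    (∀ z : ℂ, (n : ℝ) < z.re →
      Summable (fun M : Lamplighter.FinIndexSubmodule p n =>
        (Lamplighter.idx M.1 : ℂ) ^ (-z)) ∧
      LSeriesHasSum (fun m => (Lamplighter.submoduleCount p n m : ℂ)) z
        (Lamplighter.moduleZeta p n z) ∧
      Lamplighter.moduleZeta p n z = ((p : ℂ) ^ z - 1) / ((p : ℂ) ^ z - (p : ℂ) ^ n)) ∧
    -- normal subgroup growth
    (∀ m : ℕ, (Lamplighter.normalUpTo p n m).Finite) ∧
    limsup (fun m : ℕ =>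
      ((Real.log ((Lamplighter.normalUpTo p n m).ncard : ℝ) / Real.log (m : ℝ) : ℝ) : EReal))
      atTop ≤ (n : EReal) := by
  have hmod (z : ℂ) (hz : (n : ℝ) < z.re) := Lamplighter.hasSum_moduleZeta (p := p) n hz
  refine ⟨fun m hm => ?_, fun m hm => Lamplighter.finite_idx_eq p n (by omega), fun z hz => ?_,
    fun z hz => Lamplighter.hasSum_eulerProduct hz.hasSum, fun m hm => ?_, fun z hz => ?_,
    Lamplighter.finite_normalUpTo p hn, ?_⟩
  · refine (Lamplighter.finite_normalUpTo p hn m).subset fun N hN => ?_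
    have h : N.index = m := hN.2
    exact ⟨hN.1, by omega, h.le⟩
  · have h := Lamplighter.summable_normal (p := p) hn hz
    exact ⟨h, Lamplighter.lseriesHasSum_of_hasSum (fun N => N.2.2)
      (fun k hk => Lamplighter.normalCount_eq hk) h.hasSum⟩
  · rw [ArithmeticFunction.zeta_mul_apply]
    exact Lamplighter.normalCount_le (by omega)
  · have h := hmod z hz
    refine ⟨h.summable, Lamplighter.lseriesHasSum_of_hasSum (fun M => M.2) (fun k hk => ?_)
      h.summable.hasSum, h.tsum_eq⟩
    rw [Lamplighter.submoduleCount_eq hk, Lamplighter.ncard_finIndexSubmodule hk]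
  · simp only [Lamplighter.ncard_normalUpTo]
    exact Lamplighter.limsup_log_ncard_le (ℓ := fun N : Lamplighter.FinIndexNormal p n => N.1.index)
      (fun N => N.2.2) (i₀ := ⟨⊤, inferInstance, by simp⟩) Subgroup.index_top n.cast_nonneg
      fun z hz => Lamplighter.summable_normal hn hz
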